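/- Let $k$ be a field, $\mathcal Q$ a finite quiver with source and target maps $\mathfrak s,\mathfrak t$; paths are composed from left to right, i.e. $\alpha\beta$ is "first $\alpha$, then $\beta$" (and $\alpha\beta=0$ in $k\mathcal Q$ if $\mathfrak t(\alpha)\neq\mathfrak s(\beta)$). Let $\mathcal I$ be an ideal of the path algebra $k\mathcal Q$ such that $(\mathcal Q,\mathcal I)$ is an almost gentle pair, i.e. (1) $\mathcal I$ is admissible (with $J$ the ideal generated by the arrows, $J^m\subseteq \mathcal I\subseteq J^2$ for some $m\ge 2$) and is generated by a set of paths of length two; (2) for every arrow $a$ there is at most one arrow $b$ with $ab\notin\mathcal I$ and at most one arrow $c$ with $ca\notin\mathcal I$. Let $A=k\mathcal Q/\mathcal I$ be the corresponding almost gentle algebra, and let $\operatorname{inj.dim}A$ be the injective dimension of $A$ as a right $A$-module. A forbidden cycle is an oriented cycle (closed path, possibly with repeated vertices) $\mathscr C=a_0a_1\cdots a_{\ell-1}$ of arrows, $\ell\ge 1$, such that $\mathfrak t(a_i)=\mathfrak s(a_{i+1})$ and $a_ia_{i+1}\in\mathcal I$ for all $i$, where indices are taken modulo $\ell$. Write $v_i=\mathfrak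 s(a_i)$ for the vertex in position $i$ of $\mathscr C$. Then $\operatorname{inj.dim}A=\infty$ if and only if there are a forbidden cycle $\mathscr C=a_0a_1\cdots a_{\ell-1}$ of $(\mathcal Q,\mathcal I)$ and a position $i$ such that one of the following conditions holds: (A) there is an arrow $\alpha\neq a_{i-1}$ ending at $v_i$ with $\alpha a_i\in\mathcal I$; (B) there is an arrow $\beta\neq a_i$ starting at $v_i$ with $a_{i-1}\beta\in\mathcal I$. -/

import Mathlib

open CategoryTheory

namespace AlmostGentle

universe u v w

/-- The type of all paths (of arbitrary length `≥ 0`, with arbitrary end points) of the quiver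
`V`; the path `⟨x, y, p⟩` starts at `x` and ends at `y`. -/
abbrev PathOf (V : Type v) [Quiver.{w} V] : Type (max v w) :=
  Σ x y : V, Quiver.Path x y

/-- The number of arrows of a path. -/
def PathOf.length {V : Type v} [Quiver.{w} V] (p : PathOf V) : ℕ := p.2.2.length

/-- The path algebra `k V`: the free `k`-module on all paths of the quiver `V`.
Its multiplication is concatenation of paths, see `PathAlgebra.mulPath`. -/
def PathAlgebra (k : Type u) (V : Type v) [Field k] [Quiver.{w} V] : Type (max u v w) :=
  PathOf V →₀ k

namespace PathAlgebra

variable {k : Type u} {V : Type v} [Field k] [Quiver.{w} V]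

noncomputable instance : AddCommGroup (PathAlgebra k V) :=
  inferInstanceAs (AddCommGroup (PathOf V →₀ k))

noncomputable instance : Module k (PathAlgebra k V) :=
  inferInstanceAs (Module k (PathOf V →₀ k))

/-- A path, viewed as an element of the path algebra. -/
noncomputable def path (p : PathOf V) : PathAlgebra k V :=
  (Finsupp.single p 1 : PathOf V →₀ k)

/-- The coefficient of an element of the path algebra at a path. -/
def coeff (x : PathAlgebra k V) (p : PathOf V) : k :=
  (show PathOf V →₀ k from x) p

open scoped Classical in
/-- The product of two paths: first `p`, then `q`, if `p` ends where `q` starts, and `0`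
otherwise. -/
noncomputable def mulPath (p q : PathOf V) : PathAlgebra k V :=
  if h : p.2.1 = q.1 then path ⟨p.1, q.2.1, p.2.2.comp (q.2.2.cast h.symm rfl)⟩ else 0

/-- The bilinear extension of `mulPath`. -/
noncomputable def mulHom : PathAlgebra k V →ₗ[k] PathAlgebra k V →ₗ[k] PathAlgebra k V :=
  Finsupp.lift (PathAlgebra k V →ₗ[k] PathAlgebra k V) k (PathOf V)
    (fun p => Finsupp.lift (PathAlgebra k V) k (PathOf V) (fun q => mulPath p q))

noncomputable instance : Mul (PathAlgebra k V) := ⟨fun x y => mulHom x y⟩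

/-- The unit of the path algebra: the sum of the paths of length zero. -/
noncomputable instance [Fintype V] : One (PathAlgebra k V) :=
  ⟨∑ x : V, path ⟨x, x, Quiver.Path.nil⟩⟩

lemma mul_def (x y : PathAlgebra k V) : x * y = mulHom x y := rfl

lemma one_def [Fintype V] :
    (1 : PathAlgebra k V) = ∑ x : V, path ⟨x, x, Quiver.Path.nil⟩ := rfl

lemma lift_single {M : Type*} [AddCommGroup M] [Module k M] {X : Type*} (f : X → M) (p : X) :
    Finsupp.lift M k X f (Finsupp.single p 1) = f p := by
  simp

lemma path_mul_path (p q : PathOf V) : (path p * path q : PathAlgebra k V) = mulPath p q := by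
  have h₁ : mulHom (path p : PathAlgebra k V) =
      Finsupp.lift (PathAlgebra k V) k (PathOf V) (fun q => mulPath p q) := lift_single _ p
  rw [mul_def, h₁]
  exact lift_single _ q

lemma path_mul_path_of_eq {x y z : V} (p : Quiver.Path x y) (q : Quiver.Path y z) :
    (path ⟨x, y, p⟩ * path ⟨y, z, q⟩ : PathAlgebra k V) = path ⟨x, z, p.comp q⟩ := by
  rw [path_mul_path]
  simp [mulPath]

lemma path_mul_path_of_ne {p q : PathOf V} (h : p.2.1 ≠ q.1) :
    (path p * path q : PathAlgebra k V) = 0 := by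
  rw [path_mul_path, mulPath, dif_neg h]

lemma induction_on {P : PathAlgebra k V → Prop} (x : PathAlgebra k V)
    (zero : P 0) (add : ∀ x y, P x → P y → P (x + y))
    (smul_path : ∀ (c : k) (p : PathOf V), P (c • path p)) : P x := by
  refine Finsupp.induction_linear (motive := P) x zero add (fun p c => ?_)
  have h : (Finsupp.single p c : PathOf V →₀ k) = c • Finsupp.single p 1 := by simp
  rw [h]
  exact smul_path c p

lemma add_mul_aux (x y z : PathAlgebra k V) : (x + y) * z = x * z + y * z := by
  simp only [mul_def, map_add, LinearMap.add_apply]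

lemma mul_add_aux (x y z : PathAlgebra k V) : x * (y + z) = x * y + x * z := by
  simp only [mul_def, map_add]

lemma zero_mul_aux (x : PathAlgebra k V) : 0 * x = 0 := by
  simp only [mul_def, map_zero, LinearMap.zero_apply]

lemma mul_zero_aux (x : PathAlgebra k V) : x * 0 = 0 := by
  simp only [mul_def, map_zero]

lemma smul_mul_aux (c : k) (x y : PathAlgebra k V) : (c • x) * y = c • (x * y) := by
  simp only [mul_def, map_smul, LinearMap.smul_apply]

lemma mul_smul_aux (c : k) (x y : PathAlgebra k V) : x * (c • y) = c • (x * y) := by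
  simp only [mul_def, map_smul]

lemma path_mul_assoc (p q r : PathOf V) :
    (path p * path q * path r : PathAlgebra k V) = path p * (path q * path r) := by
  obtain ⟨a, b, p⟩ := p
  obtain ⟨c, d, q⟩ := q
  obtain ⟨e, f, r⟩ := r
  by_cases h : b = c
  · subst h
    rw [path_mul_path_of_eq]
    by_cases h' : d = e
    · subst h'
      rw [path_mul_path_of_eq, path_mul_path_of_eq, path_mul_path_of_eq, Quiver.Path.comp_assoc]
    · rw [path_mul_path_of_ne (by exact h'), path_mul_path_of_ne (by exact h'), mul_zero_aux]
  · rw [path_mul_path_of_ne (by exact h), zero_mul_aux]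
    by_cases h' : d = e
    · subst h'
      rw [path_mul_path_of_eq, path_mul_path_of_ne (by exact h)]
    · rw [path_mul_path_of_ne (by exact h'), mul_zero_aux]

lemma mul_assoc_aux (x y z : PathAlgebra k V) : x * y * z = x * (y * z) := by
  induction x using induction_on with
  | zero => simp only [zero_mul_aux]
  | add x x' hx hx' => simp only [add_mul_aux, hx, hx']
  | smul_path c p =>
  induction y using induction_on with
  | zero => simp only [zero_mul_aux, mul_zero_aux]
  | add x x' hx hx' => simp only [add_mul_aux, mul_add_aux, hx, hx']
  | smul_path d q =>
  induction z using induction_on with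
  | zero => simp only [mul_zero_aux]
  | add x x' hx hx' => simp only [mul_add_aux, hx, hx']
  | smul_path e r => simp only [smul_mul_aux, mul_smul_aux, path_mul_assoc]

lemma one_mul_aux [Fintype V] (x : PathAlgebra k V) : 1 * x = x := by
  induction x using induction_on with
  | zero => exact mul_zero_aux _
  | add x x' hx hx' => rw [mul_add_aux, hx, hx']
  | smul_path c p =>
    obtain ⟨a, b, p⟩ := p
    rw [mul_smul_aux, one_def, mul_def, map_sum, LinearMap.sum_apply,
      Finset.sum_eq_single a, ← mul_def, path_mul_path_of_eq, Quiver.Path.nil_comp]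
    · intro x _ hx
      rw [← mul_def, path_mul_path_of_ne (by exact hx)]
    · intro h
      exact absurd (Finset.mem_univ a) h

lemma mul_one_aux [Fintype V] (x : PathAlgebra k V) : x * 1 = x := by
  induction x using induction_on with
  | zero => exact zero_mul_aux _
  | add x x' hx hx' => rw [add_mul_aux, hx, hx']
  | smul_path c p =>
    obtain ⟨a, b, p⟩ := p
    rw [smul_mul_aux, one_def, mul_def, map_sum,
      Finset.sum_eq_single b, ← mul_def, path_mul_path_of_eq, Quiver.Path.comp_nil]
    · intro x _ hx
      rw [← mul_def, path_mul_path_of_ne (by exact hx.symm)]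
    · intro h
      exact absurd (Finset.mem_univ b) h

noncomputable instance [Fintype V] : Ring (PathAlgebra k V) where
  __ := (inferInstance : AddCommGroup (PathAlgebra k V))
  left_distrib := mul_add_aux
  right_distrib := add_mul_aux
  zero_mul := zero_mul_aux
  mul_zero := mul_zero_aux
  mul_assoc := mul_assoc_aux
  one_mul := one_mul_aux
  mul_one := mul_one_aux

noncomputable instance [Fintype V] : Algebra k (PathAlgebra k V) :=
  Algebra.ofModule smul_mul_aux mul_smul_aux

/-- An arrow, viewed as a path of length one in the path algebra. -/
noncomputable def arrow (k : Type u) {V : Type v} [Field k] [Quiver.{w} V]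
    (a : Quiver.Total V) : PathAlgebra k V :=
  path ⟨a.left, a.right, a.hom.toPath⟩

end PathAlgebra

open PathAlgebra

variable {k : Type u} {V : Type v} [Field k] [Quiver.{w} V] [Fintype V]

/-- Admissible ideals: with `J` the ideal of `k V` generated by the arrows (it is spanned by the
paths of length at least one), `I` is admissible if `J ^ m ⊆ I ⊆ J ^ 2` for some `m ≥ 2`;
here `J ^ n` is spanned by the paths of length at least `n`. -/
structure IsAdmissible (I : TwoSidedIdeal (PathAlgebra k V)) : Prop where
  path_mem : ∃ m : ℕ, 2 ≤ m ∧ ∀ p : PathOf V, m ≤ p.length → path p ∈ I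
  two_le_length : ∀ x ∈ I, ∀ p : PathOf V, coeff x p ≠ 0 → 2 ≤ p.length

/-- `(V, I)` is an almost gentle pair: `I` is an admissible ideal of `k V` that is generated by
paths of length two, and for every arrow `a` there is at most one arrow `b` with `a b ∉ I` and
at most one arrow `c` with `c a ∉ I`. (If the arrows `a`, `b` are not composable, then
`a b = 0 ∈ I`.) -/
structure IsAlmostGentlePair (I : TwoSidedIdeal (PathAlgebra k V)) : Prop where
  admissible : IsAdmissible I
  generated : ∃ R : Set (PathOf V), (∀ p ∈ R, p.length = 2) ∧
    I = TwoSidedIdeal.span {x : PathAlgebra k V | ∃ p ∈ R, x = path p}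
  right_unique : ∀ a b b' : Quiver.Total V,
    arrow k a * arrow k b ∉ I → arrow k a * arrow k b' ∉ I → b = b'
  left_unique : ∀ a c c' : Quiver.Total V,
    arrow k c * arrow k a ∉ I → arrow k c' * arrow k a ∉ I → c = c'

/-- The algebra `A = k V / I` of the bound quiver `(V, I)`. -/
abbrev BoundQuiverAlgebra (I : TwoSidedIdeal (PathAlgebra k V)) : Type (max u v w) :=
  I.ringCon.Quotient

/-- A forbidden cycle `a_0 a_1 ⋯ a_{ℓ-1}` of the bound quiver `(V, I)`, `ℓ ≥ 1`: an oriented cycle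
such that every product of two cyclically consecutive arrows lies in `I`. Indices are taken
modulo `ℓ`; the vertex in position `i` of the cycle is the source of `a_i`. -/
structure ForbiddenCycle (I : TwoSidedIdeal (PathAlgebra k V)) where
  len : ℕ
  len_pos : 0 < len
  a : ZMod len → Quiver.Total V
  target_eq_source : ∀ i, (a i).right = (a (i + 1)).left
  mul_mem : ∀ i, arrow k (a i) * arrow k (a (i + 1)) ∈ I

/-- The vertex in position `i` of a forbidden cycle. -/
def ForbiddenCycle.vertex {I : TwoSidedIdeal (PathAlgebra k V)} (C : ForbiddenCycle I)
    (i : ZMod C.len) : V :=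
  (C.a i).left

/-- Condition (A) at the vertex `v` in position `i` of `C`: there is an arrow `α ≠ a_{i-1}` ending
at `v` such that `α a_i ∈ I`. -/
def ForbiddenCycle.ConditionA {I : TwoSidedIdeal (PathAlgebra k V)} (C : ForbiddenCycle I)
    (i : ZMod C.len) : Prop :=
  ∃ α : Quiver.Total V, α.right = C.vertex i ∧ α ≠ C.a (i - 1) ∧
    arrow k α * arrow k (C.a i) ∈ I

/-- Condition (B) at the vertex `v` in position `i` of `C`: there is an arrow `β ≠ a_i` starting
at `v` such that `a_{i-1} β ∈ I`. -/
def ForbiddenCycle.ConditionB {I : TwoSidedIdeal (PathAlgebra k V)} (C : ForbiddenCycle I)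
    (i : ZMod C.len) : Prop :=
  ∃ β : Quiver.Total V, β.left = C.vertex i ∧ β ≠ C.a i ∧
    arrow k (C.a (i - 1)) * arrow k β ∈ I

/-- The self-injective dimension of a ring `A`: the injective dimension of `A` as a right module
over itself, in the category of right `A`-modules (modules over the opposite ring). -/
noncomputable def selfInjectiveDimension (A : Type u) [Ring A] : WithBot ℕ∞ :=
  injectiveDimension (ModuleCat.of.{u} Aᵐᵒᵖ A)

end AlmostGentle

/-! Write `bA` for the right ideal of an arrow `b`. The ideal `I` is spanned by the paths containing
two consecutive arrows with product in `I`, so vanishing in `A` can be tested path by path. Hence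
the kernel of the cover of `bA` by the projective of the target of `b` is the direct sum of the `cA`
with `c` starting there and `bc = 0` (`isPresentation_arr`), while the first syzygy of a simple
module is the sum of the `cA` over all arrows `c` leaving its vertex (`isPresentation_simple`).
Since `A` is artinian, its injective dimension is tested on simple modules, so everything depends on
the groups `Ext ^ n (bA, A)`, and dimension shifting follows the zero relations `bc = 0`.

The decisive case is `Ext ^ 1`: it vanishes when every family of maps `cA → A`, for `bc = 0`, is
left multiplication by one common element. This forces `c` to be unique, and forces each other arrow
`c'` ending where `c` ends to have a nonzero continuation, since otherwise `c ↦ c'` defines a map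
that is no left multiplication. Conversely, these two properties and the existence of some `d` with
`cd = 0` suffice (`extVanishes_one`).

If the injective dimension is finite, shifting backwards around a forbidden cycle gives `Ext ^ 1
(bA, A) = 0` for all its arrows, and the two necessary properties exclude (A) and (B). If (A) and
(B) never hold, the criterion applies to every arrow on a forbidden cycle, and all its positive
`Ext` groups vanish because its only successor lies on the cycle too. Away from the cycles the zero
relations are acyclic, so a well-founded induction over finitely many arrows bounds the degrees of
nonvanishing. -/

namespace AlmostGentle

/-! ### Dimension shifting and tests for injective dimension -/

section Homological

open Abelian

universe z

variable {R : Type z} [Ring R]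

/-- `Ext`-vanishing passes to a module whose identity is a finite sum of maps factoring through
modules with vanishing `Ext`. -/
lemma subsingleton_ext_of_sum_factor {X Y : ModuleCat.{z} R} {ι : Type*} [Fintype ι]
    (Z : ι → ModuleCat.{z} R) (f : ∀ i, X ⟶ Z i) (g : ∀ i, Z i ⟶ X)
    (h : ∑ i, f i ≫ g i = 𝟙 X) (n : ℕ) (hZ : ∀ i, Subsingleton (Ext (Z i) Y n)) :
    Subsingleton (Ext X Y n) := by
  refine subsingleton_of_forall_eq 0 fun x => ?_
  rw [← Ext.mk₀_id_comp x, ← h, Ext.mk₀_sum, Ext.sum_comp]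
  refine Finset.sum_eq_zero fun i _ => ?_
  rw [← Ext.mk₀_comp_mk₀_assoc]
  have := hZ i
  rw [Subsingleton.elim ((Ext.mk₀ (g i)).comp x (zero_add n)) 0, Ext.comp_zero]

lemma subsingleton_ext_pi {Y : ModuleCat.{z} R} {ι : Type} [Finite ι]
    (Z : ι → Type z) [∀ i, AddCommGroup (Z i)] [∀ i, Module R (Z i)] (n : ℕ)
    (hZ : ∀ i, Subsingleton (Ext (ModuleCat.of R (Z i)) Y n)) :
    Subsingleton (Ext (ModuleCat.of R (∀ i, Z i)) Y n) := by
  classical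
  have := Fintype.ofFinite ι
  refine subsingleton_ext_of_sum_factor (fun i => ModuleCat.of R (Z i))
    (fun i => ModuleCat.ofHom (LinearMap.proj i)) (fun i => ModuleCat.ofHom (LinearMap.single R Z i))
    ?_ n hZ
  ext x
  simp [ModuleCat.hom_sum]

lemma subsingleton_ext_of_pi {Y : ModuleCat.{z} R} {ι : Type}
    (Z : ι → Type z) [∀ i, AddCommGroup (Z i)] [∀ i, Module R (Z i)] (n : ℕ)
    (h : Subsingleton (Ext (ModuleCat.of R (∀ i, Z i)) Y n)) (i : ι) :
    Subsingleton (Ext (ModuleCat.of R (Z i)) Y n) := by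
  classical
  refine subsingleton_ext_of_sum_factor (ι := Unit) (fun _ => ModuleCat.of R (∀ i, Z i))
    (fun _ => ModuleCat.ofHom (LinearMap.single R Z i)) (fun _ => ModuleCat.ofHom (LinearMap.proj i))
    ?_ n (fun _ => h)
  ext x
  simp

variable {S : ShortComplex (ModuleCat.{z} R)} (hS : S.ShortExact) (Y : ModuleCat.{z} R)

include hS

lemma subsingleton_ext_succ_of_shortExact [Projective S.X₂] (n : ℕ)
    (h : Subsingleton (Ext S.X₁ Y n)) : Subsingleton (Ext S.X₃ Y (n + 1)) := by
  refine subsingleton_of_forall_eq 0 fun x => ?_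
  obtain ⟨y, rfl⟩ := Ext.contravariant_sequence_exact₃ hS Y x (Ext.eq_zero_of_projective _)
    (add_comm 1 n)
  rw [Subsingleton.elim y 0, Ext.comp_zero]

/-- The shift stops at degree one on `S.X₁`, because only the positive `Ext` groups of the
projective middle term vanish. -/
lemma subsingleton_ext_of_shortExact_succ [Projective S.X₂] (n : ℕ)
    (h : Subsingleton (Ext S.X₃ Y (n + 2))) : Subsingleton (Ext S.X₁ Y (n + 1)) := by
  refine subsingleton_of_forall_eq 0 fun x => ?_
  obtain ⟨y, rfl⟩ := Ext.contravariant_sequence_exact₁ hS Y x (add_comm 1 (n + 1))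
    (Subsingleton.elim _ _)
  rw [Ext.eq_zero_of_projective y, Ext.comp_zero]

lemma exists_extension_of_subsingleton_ext_one
    (h : Subsingleton (Ext S.X₃ Y 1)) (f : S.X₁ ⟶ Y) : ∃ g : S.X₂ ⟶ Y, S.f ≫ g = f := by
  obtain ⟨y, hy⟩ := Ext.contravariant_sequence_exact₁ hS Y (Ext.mk₀ f) (add_zero 1)
    (Subsingleton.elim _ _)
  obtain ⟨g, rfl⟩ := (Ext.mk₀_bijective _ _).2 y
  rw [Ext.mk₀_comp_mk₀] at hy
  exact ⟨g, (Ext.mk₀_bijective _ _).1 hy⟩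

lemma subsingleton_ext_one_of_exists_extension [Projective S.X₂]
    (h : ∀ f : S.X₁ ⟶ Y, ∃ g : S.X₂ ⟶ Y, S.f ≫ g = f) : Subsingleton (Ext S.X₃ Y 1) := by
  refine subsingleton_of_forall_eq 0 fun x => ?_
  obtain ⟨y, rfl⟩ := Ext.contravariant_sequence_exact₃ hS Y x (Ext.eq_zero_of_projective _)
    (add_zero 1)
  obtain ⟨f, rfl⟩ := (Ext.mk₀_bijective _ _).2 y
  obtain ⟨g, rfl⟩ := h f
  rw [← Ext.mk₀_comp_mk₀, ← Ext.comp_assoc (a₂ := 0) (a₁₂ := 1) _ _ _ (by simp) (by simp) (by simp)]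
  simp

lemma subsingleton_ext_middle (n : ℕ) (h₁ : Subsingleton (Ext S.X₁ Y n))
    (h₃ : Subsingleton (Ext S.X₃ Y n)) : Subsingleton (Ext S.X₂ Y n) := by
  refine subsingleton_of_forall_eq 0 fun x => ?_
  obtain ⟨y, rfl⟩ := Ext.contravariant_sequence_exact₂ hS Y x (Subsingleton.elim _ _)
  rw [Subsingleton.elim y 0, Ext.comp_zero]

omit hS

/-- The short exact sequence given by a submodule and its quotient. -/
lemma shortExact_submodule (M : Type z) [AddCommGroup M] [Module R M] (N : Submodule R M) :
    (ModuleCat.shortComplexOfCompEqZero N.subtype N.mkQ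
      (by ext; simp)).ShortExact :=
  ModuleCat.shortComplex_shortExact _ (LinearMap.exact_subtype_mkQ N) N.injective_subtype
    N.mkQ_surjective

/-- Induction along a composition series, using the middle term of the long exact sequence. -/
lemma subsingleton_ext_of_isFiniteLength (n : ℕ)
    (h : ∀ (M : Type z) [AddCommGroup M] [Module R M], IsSimpleModule R M →
      Subsingleton (Ext (ModuleCat.of R M) Y n))
    {M : Type z} [AddCommGroup M] [Module R M] (hM : IsFiniteLength R M) :
    Subsingleton (Ext (ModuleCat.of R M) Y n) := by
  induction hM with
  | @of_subsingleton M _ _ _ =>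
    refine subsingleton_of_forall_eq 0 fun x => ?_
    rw [← Ext.mk₀_id_comp x, (ModuleCat.isZero_of_subsingleton (ModuleCat.of R M)).eq_of_src
      (𝟙 _) 0, Ext.mk₀_zero, Ext.zero_comp]
  | @of_simple_quotient M _ _ N hs _ ih =>
    exact subsingleton_ext_middle (shortExact_submodule M N) Y n ih (h _ hs)

/-- Baer's criterion: the obstruction to extending a map from `J` to `R` lies in `Ext ^ 1 (R ⧸ J,
Y)`. -/
lemma injective_of_subsingleton_ext_one
    (h : ∀ J : Ideal R, Subsingleton (Ext (ModuleCat.of R (R ⧸ J)) Y 1)) : Injective Y := by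
  have hb : Module.Baer R Y := fun J g => by
    obtain ⟨g', hg'⟩ := exists_extension_of_subsingleton_ext_one (shortExact_submodule R J) Y (h J)
      (ModuleCat.ofHom g)
    refine ⟨g'.hom, fun x hx => ?_⟩
    exact LinearMap.congr_fun (ModuleCat.hom_ext_iff.1 hg') ⟨x, hx⟩
  have : Module.Injective R Y := Module.Baer.iff_injective.1 hb
  exact Module.injective_object_of_injective_module R Y

/-- Embedding `Y` in an injective object and passing to the cokernel lowers both the degree and the
dimension by one, down to Baer's criterion. -/
lemma hasInjectiveDimensionLE_of_subsingleton_ext_quotient (n : ℕ)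
    (h : ∀ J : Ideal R, Subsingleton (Ext (ModuleCat.of R (R ⧸ J)) Y (n + 1))) :
    HasInjectiveDimensionLE Y n := by
  induction n generalizing Y with
  | zero =>
    rw [HasInjectiveDimensionLE, zero_add, ← injective_iff_hasInjectiveDimensionLT_one]
    exact injective_of_subsingleton_ext_one Y h
  | succ n ih =>
    obtain ⟨I, _, f, _⟩ := EnoughInjectives.presentation Y
    have hT : (ShortComplex.mk f (Limits.cokernel.π f) (Limits.cokernel.condition f)).ShortExact :=
      { exact := ShortComplex.exact_cokernel f }
    refine (hT.hasInjectiveDimensionLT_X₃_iff n inferInstance).1 (ih _ fun J => ?_)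
    refine subsingleton_of_forall_eq 0 fun x => ?_
    have := h J
    obtain ⟨y, rfl⟩ := Ext.covariant_sequence_exact₃ _ hT x rfl (Subsingleton.elim _ _)
    rw [Ext.eq_zero_of_injective y, Ext.zero_comp]

lemma hasInjectiveDimensionLE_of_subsingleton_ext_simple [IsNoetherianRing R] [IsArtinianRing R]
    (n : ℕ) (h : ∀ (M : Type z) [AddCommGroup M] [Module R M], IsSimpleModule R M →
      Subsingleton (Ext (ModuleCat.of R M) Y (n + 1))) :
    HasInjectiveDimensionLE Y n :=
  hasInjectiveDimensionLE_of_subsingleton_ext_quotient Y n fun _ =>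
    subsingleton_ext_of_isFiniteLength Y (n + 1) h
      (isFiniteLength_iff_isNoetherian_isArtinian.2 ⟨inferInstance, inferInstance⟩)

end Homological

/-! ### Paths, coefficients, and the monomial description of the ideal -/

section Paths

universe u v w

open PathAlgebra

variable {k : Type u} {V : Type v} [Field k] [Quiver.{w} V]

/-- The list of arrows of a path. -/
def pathWord {x : V} : ∀ {y : V}, Quiver.Path x y → List (Quiver.Total V)
  | _, .nil => []
  | _, .cons p a => pathWord p ++ [⟨_, _, a⟩]

lemma pathWord_comp {x y z : V} (p : Quiver.Path x y) (q : Quiver.Path y z) :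
    pathWord (p.comp q) = pathWord p ++ pathWord q := by
  induction q with
  | nil => simp [pathWord]
  | cons q a ih => simp [pathWord, ih]

/-- The path that starts with the arrow `c` and goes on with `q`. -/
abbrev consLeft (c : Quiver.Total V) {y : V} (q : Quiver.Path c.right y) : PathOf V :=
  ⟨c.left, y, c.hom.toPath.comp q⟩

/-- The path that ends with the arrow `c`, after `q`. -/
abbrev consRight {x : V} (c : Quiver.Total V) (q : Quiver.Path x c.left) : PathOf V :=
  ⟨x, c.right, q.cons c.hom⟩

/-- The path of length zero at a vertex. -/
abbrev nilPath (x : V) : PathOf V := ⟨x, x, .nil⟩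

/-- Paths with different end points have different types; comparing the words of arrows avoids
transporting along equalities of vertices. -/
lemma consLeft_injective_arrow {c d : Quiver.Total V} {y z : V} {p : Quiver.Path c.right y}
    {q : Quiver.Path d.right z} (h : consLeft c p = consLeft d q) : c = d := by
  have h' := congrArg (fun r : PathOf V => pathWord r.2.2) h
  rw [Quiver.Total.ext_iff]
  simp only [pathWord_comp, Quiver.Hom.toPath, pathWord, List.nil_append, List.singleton_append,
    List.cons.injEq, Quiver.Total.ext_iff] at h'
  exact h'.1

lemma consLeft_injective_path {c : Quiver.Total V} {y z : V} {p : Quiver.Path c.right y}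
    {q : Quiver.Path c.right z} (h : consLeft c p = consLeft c q) :
    (⟨_, _, p⟩ : PathOf V) = ⟨_, _, q⟩ := by
  obtain ⟨rfl, h⟩ := Sigma.mk.inj_iff.1 (eq_of_heq (Sigma.mk.inj_iff.1 h).2)
  rw [Quiver.Path.comp_injective_right _ (eq_of_heq h)]

lemma consRight_injective_arrow {c d : Quiver.Total V} {x y : V} {p : Quiver.Path x c.left}
    {q : Quiver.Path y d.left} (h : consRight c p = consRight d q) : c = d := by
  have h' := congrArg (fun r : PathOf V => pathWord r.2.2) h
  exact (List.concat_inj.1 (by simpa only [pathWord, List.concat_eq_append] using h')).2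

lemma consRight_injective_path {c : Quiver.Total V} {x y : V} {p : Quiver.Path x c.left}
    {q : Quiver.Path y c.left} (h : consRight c p = consRight c q) :
    (⟨_, _, p⟩ : PathOf V) = ⟨_, _, q⟩ := by
  obtain ⟨rfl, h⟩ := Sigma.mk.inj_iff.1 h
  have h' := eq_of_heq (Sigma.mk.inj_iff.1 (eq_of_heq h)).2
  rw [eq_of_heq (Quiver.Path.heq_of_cons_eq_cons h')]

lemma exists_eq_nilPath_or_consLeft (p : PathOf V) :
    (∃ x, p = nilPath x) ∨ ∃ (c : Quiver.Total V) (y : V) (q : Quiver.Path c.right y),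
      p = consLeft c q := by
  obtain ⟨x, y, p⟩ := p
  by_cases h : p.length = 0
  · obtain rfl := Quiver.Path.eq_of_length_zero p h
    exact .inl ⟨x, by rw [Quiver.Path.eq_nil_of_length_zero p h]⟩
  · obtain ⟨z, e, q, rfl, -⟩ := (Quiver.Path.length_ne_zero_iff_eq_comp p).1 h
    exact .inr ⟨⟨x, z, e⟩, y, q, rfl⟩

lemma length_consLeft (c : Quiver.Total V) {y : V} (q : Quiver.Path c.right y) :
    (consLeft c q).length = q.length + 1 := by
  simp [PathOf.length, add_comm]

namespace PathAlgebra

/-- The coefficient at a path, as a linear map. -/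
noncomputable def coeffHom (p : PathOf V) : PathAlgebra k V →ₗ[k] k :=
  (Finsupp.lapply p : (PathOf V →₀ k) →ₗ[k] k)

lemma coeff_path_self (p : PathOf V) : coeff (path p : PathAlgebra k V) p = 1 :=
  Finsupp.single_eq_same

lemma coeff_path_of_ne {p q : PathOf V} (h : p ≠ q) : coeff (path p : PathAlgebra k V) q = 0 :=
  Finsupp.single_eq_of_ne h.symm

lemma eq_of_coeff_path_ne_zero {p q : PathOf V} (h : coeff (path p : PathAlgebra k V) q ≠ 0) :
    p = q := by
  by_contra h'
  exact h (coeff_path_of_ne h')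

lemma coeff_zero (p : PathOf V) : coeff (0 : PathAlgebra k V) p = 0 := rfl

lemma coeff_add (x y : PathAlgebra k V) (p : PathOf V) :
    coeff (x + y) p = coeff x p + coeff y p := rfl

lemma coeff_sub (x y : PathAlgebra k V) (p : PathOf V) :
    coeff (x - y) p = coeff x p - coeff y p := map_sub (coeffHom p) x y

lemma coeff_smul (c : k) (x : PathAlgebra k V) (p : PathOf V) :
    coeff (c • x) p = c * coeff x p := rfl

lemma coeff_sum {ι : Type*} (s : Finset ι) (f : ι → PathAlgebra k V) (p : PathOf V) :
    coeff (∑ i ∈ s, f i) p = ∑ i ∈ s, coeff (f i) p := map_sum (coeffHom p) f s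

lemma mem_span_path (x : PathAlgebra k V) :
    x ∈ Submodule.span k {y : PathAlgebra k V | ∃ p, coeff x p ≠ 0 ∧ y = path p} := by
  have hx : x = Finsupp.sum (show PathOf V →₀ k from x)
      (fun p c => (c • path p : PathAlgebra k V)) := by
    conv_lhs => rw [← Finsupp.sum_single (show PathOf V →₀ k from x)]
    refine Finset.sum_congr rfl fun p _ => ?_
    exact (Finsupp.smul_single_one p _).symm
  have key : Finsupp.sum (show PathOf V →₀ k from x)
      (fun p c => (c • path p : PathAlgebra k V)) ∈
      Submodule.span k {y : PathAlgebra k V | ∃ p, coeff x p ≠ 0 ∧ y = path p} :=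
    Submodule.sum_mem _ fun p hp => Submodule.smul_mem _ _
      (Submodule.subset_span ⟨p, Finsupp.mem_support_iff.1 hp, rfl⟩)
  rw [← hx] at key
  exact key

lemma arrow_mul_path (c : Quiver.Total V) {y : V} (q : Quiver.Path c.right y) :
    arrow k c * path ⟨_, _, q⟩ = path (consLeft c q) :=
  path_mul_path_of_eq _ _

lemma path_mul_arrow (c : Quiver.Total V) {x : V} (q : Quiver.Path x c.left) :
    path ⟨_, _, q⟩ * arrow k c = path (consRight c q) :=
  path_mul_path_of_eq _ _

/-- Prefixing an arrow is injective on the paths that start at its target, so no two terms of the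
product collide. -/
lemma coeff_arrow_mul (c : Quiver.Total V) (x : PathAlgebra k V) {y : V}
    (q : Quiver.Path c.right y) : coeff (arrow k c * x) (consLeft c q) = coeff x ⟨_, _, q⟩ := by
  induction x using induction_on with
  | zero => rw [mul_zero_aux, coeff_zero, coeff_zero]
  | add x x' hx hx' => rw [mul_add_aux, coeff_add, coeff_add, hx, hx']
  | smul_path d p =>
    rw [mul_smul_aux, coeff_smul, coeff_smul]
    congr 1
    obtain ⟨a, b, p⟩ := p
    by_cases h : c.right = a
    · subst h
      rw [arrow_mul_path]
      by_cases h' : (⟨_, _, p⟩ : PathOf V) = ⟨_, _, q⟩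
      · rw [h', coeff_path_self]
        have : consLeft c p = consLeft c q := by
          obtain ⟨rfl, h'⟩ := Sigma.mk.inj_iff.1 (eq_of_heq (Sigma.mk.inj_iff.1 h').2)
          rw [eq_of_heq h']
        rw [this, coeff_path_self]
      · rw [coeff_path_of_ne h', coeff_path_of_ne fun h => h' (consLeft_injective_path h)]
    · rw [arrow, path_mul_path_of_ne (by exact h), coeff_zero, coeff_path_of_ne]
      intro h'
      exact h (congrArg Sigma.fst h').symm

lemma coeff_mul_arrow (c : Quiver.Total V) (x : PathAlgebra k V) {y : V}
    (q : Quiver.Path y c.left) : coeff (x * arrow k c) (consRight c q) = coeff x ⟨_, _, q⟩ := by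
  induction x using induction_on with
  | zero => rw [zero_mul_aux, coeff_zero, coeff_zero]
  | add x x' hx hx' => rw [add_mul_aux, coeff_add, coeff_add, hx, hx']
  | smul_path d p =>
    rw [smul_mul_aux, coeff_smul, coeff_smul]
    congr 1
    obtain ⟨a, b, p⟩ := p
    by_cases h : b = c.left
    · subst h
      rw [path_mul_arrow]
      by_cases h' : (⟨_, _, p⟩ : PathOf V) = ⟨_, _, q⟩
      · rw [h', coeff_path_self]
        have : consRight c p = consRight c q := by
          obtain ⟨rfl, h'⟩ := Sigma.mk.inj_iff.1 h'
          rw [eq_of_heq (Sigma.mk.inj_iff.1 (eq_of_heq h')).2]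
        rw [this, coeff_path_self]
      · rw [coeff_path_of_ne h', coeff_path_of_ne fun h => h' (consRight_injective_path h)]
    · rw [arrow, path_mul_path_of_ne (by exact h), coeff_zero, coeff_path_of_ne]
      intro h'
      exact h (congrArg (fun r : PathOf V => r.2.1) h')

lemma exists_of_coeff_arrow_mul_ne_zero {c : Quiver.Total V} {x : PathAlgebra k V} {p : PathOf V}
    (h : coeff (arrow k c * x) p ≠ 0) :
    ∃ (y : V) (q : Quiver.Path c.right y), p = consLeft c q := by
  induction x using induction_on with
  | zero => exact absurd (by rw [mul_zero_aux, coeff_zero]) h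
  | add x x' hx hx' =>
    rw [mul_add_aux, coeff_add] at h
    by_cases h' : coeff (arrow k c * x) p = 0
    · exact hx' (by simpa [h'] using h)
    · exact hx h'
  | smul_path d q =>
    rw [mul_smul_aux, coeff_smul] at h
    obtain ⟨a, b, q⟩ := q
    by_cases h' : c.right = a
    · subst h'
      rw [arrow_mul_path] at h
      exact ⟨b, q, (eq_of_coeff_path_ne_zero (right_ne_zero_of_mul h)).symm⟩
    · rw [arrow, path_mul_path_of_ne (by exact h'), coeff_zero, mul_zero] at h
      exact absurd rfl h

lemma exists_of_coeff_mul_arrow_ne_zero {c : Quiver.Total V} {x : PathAlgebra k V} {p : PathOf V}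
    (h : coeff (x * arrow k c) p ≠ 0) :
    ∃ (y : V) (q : Quiver.Path y c.left), p = consRight c q := by
  induction x using induction_on with
  | zero => exact absurd (by rw [zero_mul_aux, coeff_zero]) h
  | add x x' hx hx' =>
    rw [add_mul_aux, coeff_add] at h
    by_cases h' : coeff (x * arrow k c) p = 0
    · exact hx' (by simpa [h'] using h)
    · exact hx h'
  | smul_path d q =>
    rw [smul_mul_aux, coeff_smul] at h
    obtain ⟨a, b, q⟩ := q
    by_cases h' : b = c.left
    · subst h'
      rw [path_mul_arrow] at h
      exact ⟨a, q, (eq_of_coeff_path_ne_zero (right_ne_zero_of_mul h)).symm⟩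
    · rw [arrow, path_mul_path_of_ne (by exact h'), coeff_zero, mul_zero] at h
      exact absurd rfl h

/-- The idempotent of a vertex, in the path algebra. -/
noncomputable def vertex (k : Type u) {V : Type v} [Field k] [Quiver.{w} V] (x : V) :
    PathAlgebra k V :=
  path (nilPath x)

lemma exists_eq_sum_vertex_add_sum_arrow_mul [Fintype V] [Fintype (Quiver.Total V)]
    (x : PathAlgebra k V) : ∃ (l : V → k) (f : Quiver.Total V → PathAlgebra k V),
      x = ∑ y, l y • vertex k y + ∑ c, arrow k c * f c := by
  classical
  induction x using induction_on with
  | zero => exact ⟨0, 0, by simp⟩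
  | add x x' hx hx' =>
    obtain ⟨l, f, h⟩ := hx
    obtain ⟨l', f', h'⟩ := hx'
    refine ⟨l + l', f + f', ?_⟩
    simp only [Pi.add_apply, add_smul, mul_add_aux, Finset.sum_add_distrib]
    rw [h, h']
    abel
  | smul_path d p =>
    obtain ⟨x, rfl⟩ | ⟨c, y, q, rfl⟩ := exists_eq_nilPath_or_consLeft p
    · refine ⟨Pi.single x d, 0, ?_⟩
      rw [Finset.sum_eq_single x (by intro y _ h; simp [h]) (by simp)]
      simp [vertex]
    · refine ⟨0, Pi.single c (d • path ⟨_, _, q⟩), ?_⟩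
      rw [Finset.sum_eq_single c (s := Finset.univ (α := Quiver.Total V))
        (by intro y _ h; simp [h]) (by simp)]
      simp [arrow_mul_path]

end PathAlgebra

variable [Fintype V] {I : TwoSidedIdeal (PathAlgebra k V)}

/-- Paths containing two consecutive arrows whose product lies in `I`. -/
inductive HasRelation (I : TwoSidedIdeal (PathAlgebra k V)) :
    ∀ {x y : V}, Quiver.Path x y → Prop
  | last {x y z t : V} (p : Quiver.Path x y) (a : y ⟶ z) (b : z ⟶ t)
      (h : arrow k ⟨_, _, a⟩ * arrow k ⟨_, _, b⟩ ∈ I) : HasRelation I ((p.cons a).cons b)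
  | cons {x y z : V} (p : Quiver.Path x y) (a : y ⟶ z) (h : HasRelation I p) :
      HasRelation I (p.cons a)

lemma HasRelation.comp_right {x y z : V} {p : Quiver.Path x y} (h : HasRelation I p)
    (q : Quiver.Path y z) : HasRelation I (p.comp q) := by
  induction q with
  | nil => exact h
  | cons q a ih => exact .cons _ _ ih

lemma HasRelation.comp_left {x y z : V} {q : Quiver.Path y z} (h : HasRelation I q)
    (p : Quiver.Path x y) : HasRelation I (p.comp q) := by
  induction h with
  | last q a b h => exact .last _ _ _ h
  | cons q a _ ih => exact .cons _ _ ih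

lemma HasRelation.path_mem {x y : V} {p : Quiver.Path x y} (h : HasRelation I p) :
    path ⟨x, y, p⟩ ∈ I := by
  induction h with
  | last p a b h =>
    have := I.mul_mem_left (path ⟨_, _, p⟩) _ h
    rwa [← mul_assoc, path_mul_arrow ⟨_, _, a⟩ p, path_mul_arrow ⟨_, _, b⟩ (p.cons a)] at this
  | cons p a _ ih =>
    rw [← path_mul_arrow ⟨_, _, a⟩ p]
    exact I.mul_mem_right _ _ ih

/-- The two-sided ideal spanned by the paths with a relation. -/
noncomputable def relationIdeal (I : TwoSidedIdeal (PathAlgebra k V)) :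
    TwoSidedIdeal (PathAlgebra k V) :=
  TwoSidedIdeal.mk'
    (Submodule.span k {y : PathAlgebra k V | ∃ p : PathOf V, HasRelation I p.2.2 ∧ y = path p} :
      Set (PathAlgebra k V))
    (Submodule.zero_mem _) (Submodule.add_mem _) (Submodule.neg_mem _)
    (fun {x y} hy => by
      induction hy using Submodule.span_induction with
      | zero => rw [mul_zero]; exact Submodule.zero_mem _
      | add y y' _ _ h h' => rw [mul_add]; exact Submodule.add_mem _ h h'
      | smul c y _ h => rw [mul_smul_aux]; exact Submodule.smul_mem _ _ h
      | mem y hy =>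
        obtain ⟨⟨a, b, p⟩, hp, rfl⟩ := hy
        induction x using induction_on with
        | zero => rw [zero_mul]; exact Submodule.zero_mem _
        | add y y' h h' => rw [add_mul]; exact Submodule.add_mem _ h h'
        | smul_path c q =>
          rw [smul_mul_aux]
          refine Submodule.smul_mem _ _ ?_
          obtain ⟨d, e, q⟩ := q
          by_cases h : e = a
          · subst h
            rw [path_mul_path_of_eq]
            exact Submodule.subset_span ⟨_, hp.comp_left q, rfl⟩
          · rw [path_mul_path_of_ne (by exact h)]; exact Submodule.zero_mem _)
    (fun {x y} hy => by
      induction hy using Submodule.span_induction with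
      | zero => rw [zero_mul]; exact Submodule.zero_mem _
      | add y y' _ _ h h' => rw [add_mul]; exact Submodule.add_mem _ h h'
      | smul c y _ h => rw [smul_mul_aux]; exact Submodule.smul_mem _ _ h
      | mem y hy =>
        obtain ⟨⟨a, b, p⟩, hp, rfl⟩ := hy
        induction y using induction_on with
        | zero => rw [mul_zero]; exact Submodule.zero_mem _
        | add y y' h h' => rw [mul_add]; exact Submodule.add_mem _ h h'
        | smul_path c q =>
          rw [mul_smul_aux]
          refine Submodule.smul_mem _ _ ?_
          obtain ⟨d, e, q⟩ := q
          by_cases h : b = d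
          · subst h
            rw [path_mul_path_of_eq]
            exact Submodule.subset_span ⟨_, hp.comp_right q, rfl⟩
          · rw [path_mul_path_of_ne (by exact h)]; exact Submodule.zero_mem _)

lemma mem_relationIdeal {x : PathAlgebra k V} : x ∈ relationIdeal I ↔
    x ∈ Submodule.span k
      {y : PathAlgebra k V | ∃ p : PathOf V, HasRelation I p.2.2 ∧ y = path p} :=
  TwoSidedIdeal.mem_mk' ..

namespace IsAlmostGentlePair

variable (hI : IsAlmostGentlePair I)

include hI

/-- A generator of length two is itself a pair of consecutive arrows with product in `I`. Together
with `HasRelation.path_mem`, this makes `I` the span of the paths with a relation. -/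
lemma le_relationIdeal : I ≤ relationIdeal I := by
  obtain ⟨R, hR, h⟩ := hI.generated
  conv_lhs => rw [h]
  refine TwoSidedIdeal.span_le.2 ?_
  rintro _ ⟨⟨x, y, p⟩, hp, rfl⟩
  refine mem_relationIdeal.2 (Submodule.subset_span ⟨_, ?_, rfl⟩)
  have hmem : path ⟨x, y, p⟩ ∈ I := by
    rw [h]
    exact TwoSidedIdeal.subset_span ⟨_, hp, rfl⟩
  have hl := hR _ hp
  change p.length = 2 at hl
  obtain _ | ⟨p, b⟩ := p
  · simp at hl
  obtain _ | ⟨p, a⟩ := p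
  · simp at hl
  obtain _ | ⟨p, c⟩ := p
  · refine .last _ _ _ ?_
    rwa [arrow, arrow, path_mul_path_of_eq]
  · simp at hl

lemma hasRelation_of_coeff_ne_zero {x : PathAlgebra k V} (hx : x ∈ I) {p : PathOf V}
    (hp : coeff x p ≠ 0) : HasRelation I p.2.2 := by
  have h := mem_relationIdeal.1 (hI.le_relationIdeal hx)
  by_contra hn
  have h' : Submodule.span k
      {y : PathAlgebra k V | ∃ p : PathOf V, HasRelation I p.2.2 ∧ y = path p} ≤
      LinearMap.ker (coeffHom p) := by
    refine Submodule.span_le.2 ?_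
    rintro _ ⟨q, hq, rfl⟩
    exact coeff_path_of_ne fun h => hn (h ▸ hq)
  exact hp (h' h)

omit hI in
lemma _root_.AlmostGentle.mem_of_forall_hasRelation {x : PathAlgebra k V}
    (h : ∀ p : PathOf V, coeff x p ≠ 0 → HasRelation I p.2.2) : x ∈ I := by
  have := mem_span_path x
  refine Submodule.span_induction (p := fun y _ => y ∈ I) ?_ I.zero_mem
    (fun _ _ _ _ => I.add_mem) ?_ this
  · rintro _ ⟨p, hp, rfl⟩
    exact (h p hp).path_mem
  · intro c y _ hy
    have := I.mul_mem_left (algebraMap k _ c) y hy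
    rwa [← Algebra.smul_def] at this

omit hI in
lemma _root_.AlmostGentle.not_hasRelation_nil (x : V) :
    ¬ HasRelation I (.nil : Quiver.Path x x) := nofun

omit hI in
lemma _root_.AlmostGentle.not_hasRelation_toPath {x y : V} (a : x ⟶ y) :
    ¬ HasRelation I a.toPath := by
  intro h
  cases h with
  | cons _ _ h => exact not_hasRelation_nil _ h

omit hI in
lemma _root_.AlmostGentle.HasRelation.of_cons {x y z t : V} {p : Quiver.Path x y} {a : y ⟶ z}
    {b : z ⟶ t} (h : HasRelation I ((p.cons a).cons b)) :
    HasRelation I (p.cons a) ∨ arrow k ⟨_, _, a⟩ * arrow k ⟨_, _, b⟩ ∈ I := by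
  cases h with
  | last _ _ _ h => exact .inr h
  | cons _ _ h => exact .inl h

omit hI in
-- `HasRelation` peels arrows off at the end of a path; this is the corresponding peeling at the
-- start, by induction on the tail.
lemma _root_.AlmostGentle.HasRelation.of_comp {x y z t : V} {a : x ⟶ y}
    {b : y ⟶ z} {q : Quiver.Path z t} (h : HasRelation I (a.toPath.comp (b.toPath.comp q))) :
    HasRelation I (b.toPath.comp q) ∨ arrow k ⟨_, _, a⟩ * arrow k ⟨_, _, b⟩ ∈ I := by
  induction q with
  | nil =>
    obtain h | h := HasRelation.of_cons (p := .nil) (a := a) (b := b) h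
    · exact absurd h (not_hasRelation_toPath a)
    · exact .inr h
  | cons q c ih =>
    obtain _ | ⟨q, d⟩ := q
    · obtain h | h := HasRelation.of_cons (p := a.toPath) (a := b) (b := c) h
      · exact .inr ((HasRelation.of_cons (p := .nil) (a := a) (b := b) h).resolve_left
          (not_hasRelation_toPath a))
      · exact .inl (.last _ _ _ h)
    · obtain h | h := HasRelation.of_cons (p := a.toPath.comp (b.toPath.comp q)) h
      · exact (ih h).imp (fun h => .cons _ _ h) id
      · exact .inl (.last _ _ _ h)

end IsAlmostGentlePair

end Paths

/-! ### Computing in the bound quiver algebra -/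

section Algebra

universe u v w

open PathAlgebra

variable {k : Type u} {V : Type v} [Field k] [Quiver.{w} V]

namespace PathAlgebra

lemma exists_eq_sum_vertex_add_sum_mul_arrow [Fintype V] [Fintype (Quiver.Total V)]
    (x : PathAlgebra k V) : ∃ (l : V → k) (f : Quiver.Total V → PathAlgebra k V),
      x = ∑ y, l y • vertex k y + ∑ c, f c * arrow k c := by
  classical
  induction x using induction_on with
  | zero => exact ⟨0, 0, by simp⟩
  | add x x' hx hx' =>
    obtain ⟨l, f, h⟩ := hx
    obtain ⟨l', f', h'⟩ := hx'
    refine ⟨l + l', f + f', ?_⟩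
    simp only [Pi.add_apply, add_smul, add_mul_aux, Finset.sum_add_distrib]
    rw [h, h']
    abel
  | smul_path d p =>
    obtain ⟨x, y, p⟩ := p
    obtain _ | ⟨q, c⟩ := p
    · refine ⟨Pi.single x d, 0, ?_⟩
      rw [Finset.sum_eq_single x (by intro y _ h; simp [h]) (by simp)]
      simp [vertex]
    · refine ⟨0, Pi.single ⟨_, _, c⟩ (d • path ⟨_, _, q⟩), ?_⟩
      rw [Finset.sum_eq_single ⟨_, _, c⟩ (s := Finset.univ (α := Quiver.Total V))
        (by intro y _ h; simp [h]) (by simp)]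
      simp [path_mul_arrow ⟨_, _, c⟩ q]

lemma coeff_mul_arrow_toPath (c : Quiver.Total V) (y : PathAlgebra k V) :
    coeff (y * arrow k c) ⟨c.left, c.right, c.hom.toPath⟩ = coeff y (nilPath c.left) :=
  coeff_mul_arrow c y .nil

variable [Fintype V]

lemma coeff_sum_vertex (l : V → k) (y : V) :
    coeff (∑ z, l z • vertex k z) (nilPath y) = l y := by
  rw [coeff_sum, Finset.sum_eq_single y]
  · rw [coeff_smul, vertex, coeff_path_self, mul_one]
  · intro z _ hz
    rw [coeff_smul, vertex, coeff_path_of_ne, mul_zero]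
    intro h
    exact hz (congrArg Sigma.fst h)
  · simp

lemma coeff_sum_vertex_of_length_ne_zero (l : V → k) {p : PathOf V} (hp : p.length ≠ 0) :
    coeff (∑ z, l z • vertex k z) p = 0 := by
  rw [coeff_sum]
  refine Finset.sum_eq_zero fun z _ => ?_
  rw [coeff_smul, vertex, coeff_path_of_ne, mul_zero]
  rintro rfl
  exact hp rfl

variable [Fintype (Quiver.Total V)]

lemma coeff_decomposition_nil (l : V → k) (f : Quiver.Total V → PathAlgebra k V) (y : V) :
    coeff (∑ z, l z • vertex k z + ∑ c, arrow k c * f c) (nilPath y) = l y := by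
  rw [coeff_add, coeff_sum_vertex, coeff_sum, Finset.sum_eq_zero, add_zero]
  intro c _
  by_contra h
  obtain ⟨z, q, hq⟩ := exists_of_coeff_arrow_mul_ne_zero h
  have := congrArg PathOf.length hq
  rw [length_consLeft] at this
  simp [PathOf.length] at this

lemma coeff_decomposition_consLeft (l : V → k) (f : Quiver.Total V → PathAlgebra k V)
    (c : Quiver.Total V) {y : V} (q : Quiver.Path c.right y) :
    coeff (∑ z, l z • vertex k z + ∑ c, arrow k c * f c) (consLeft c q) =
      coeff (arrow k c * f c) (consLeft c q) := by
  rw [coeff_add, coeff_sum_vertex_of_length_ne_zero _ (by simp [length_consLeft]), zero_add,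
    coeff_sum, Finset.sum_eq_single c _ (by simp)]
  intro d _ hd
  by_contra h
  obtain ⟨z, q', hq⟩ := exists_of_coeff_arrow_mul_ne_zero h
  exact hd (consLeft_injective_arrow hq).symm

lemma coeff_right_decomposition_nil (l : V → k) (f : Quiver.Total V → PathAlgebra k V) (y : V) :
    coeff (∑ z, l z • vertex k z + ∑ c, f c * arrow k c) (nilPath y) = l y := by
  rw [coeff_add, coeff_sum_vertex, coeff_sum, Finset.sum_eq_zero, add_zero]
  intro c _
  by_contra h
  obtain ⟨z, q, hq⟩ := exists_of_coeff_mul_arrow_ne_zero h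
  have := congrArg PathOf.length hq
  simp [PathOf.length] at this

lemma coeff_decomposition_consRight (l : V → k) (f : Quiver.Total V → PathAlgebra k V)
    (c : Quiver.Total V) {y : V} (q : Quiver.Path y c.left) :
    coeff (∑ z, l z • vertex k z + ∑ c, f c * arrow k c) (consRight c q) =
      coeff (f c * arrow k c) (consRight c q) := by
  rw [coeff_add, coeff_sum_vertex_of_length_ne_zero _ (by simp [PathOf.length]), zero_add,
    coeff_sum, Finset.sum_eq_single c _ (by simp)]
  intro d _ hd
  by_contra h
  obtain ⟨z, q', hq⟩ := exists_of_coeff_mul_arrow_ne_zero h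
  exact hd (consRight_injective_arrow hq).symm

end PathAlgebra

variable [Fintype V] (I : TwoSidedIdeal (PathAlgebra k V))

/-- The projection from the path algebra to the bound quiver algebra. -/
noncomputable def toBound : PathAlgebra k V →ₐ[k] BoundQuiverAlgebra I := I.ringCon.mkₐ k

/-- The idempotent of a vertex, in the bound quiver algebra. -/
noncomputable def idem (y : V) : BoundQuiverAlgebra I := toBound I (vertex k y)

/-- The class of an arrow, in the bound quiver algebra. -/
noncomputable def arr (a : Quiver.Total V) : BoundQuiverAlgebra I := toBound I (arrow k a)

lemma toBound_surjective : Function.Surjective (toBound I) := I.ringCon.mkₐ_surjective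

lemma toBound_eq_zero_iff {x : PathAlgebra k V} : toBound I x = 0 ↔ x ∈ I := by
  rw [TwoSidedIdeal.mem_iff]
  exact I.ringCon.eq (a := x) (b := 0)

lemma arr_mul_arr_eq_zero_iff {a b : Quiver.Total V} :
    arr I a * arr I b = 0 ↔ arrow k a * arrow k b ∈ I := by
  rw [arr, arr, ← map_mul, toBound_eq_zero_iff]

lemma idem_mul_idem (y : V) : idem I y * idem I y = idem I y := by
  rw [idem, ← map_mul, vertex, path_mul_path_of_eq, Quiver.Path.comp_nil]

lemma idem_mul_idem_of_ne {y z : V} (h : y ≠ z) : idem I y * idem I z = 0 := by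
  rw [idem, idem, ← map_mul, vertex, vertex, path_mul_path_of_ne (by exact h), map_zero]

lemma idem_mul_arr (a : Quiver.Total V) : idem I a.left * arr I a = arr I a := by
  rw [idem, arr, ← map_mul, vertex, arrow, path_mul_path_of_eq, Quiver.Path.nil_comp]

lemma idem_mul_arr_of_ne {y : V} {a : Quiver.Total V} (h : y ≠ a.left) :
    idem I y * arr I a = 0 := by
  rw [idem, arr, ← map_mul, vertex, arrow, path_mul_path_of_ne (by exact h), map_zero]

lemma arr_mul_idem (a : Quiver.Total V) : arr I a * idem I a.right = arr I a := by
  rw [idem, arr, ← map_mul, vertex, arrow, path_mul_path_of_eq, Quiver.Path.comp_nil]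

lemma arr_mul_idem_of_ne {y : V} {a : Quiver.Total V} (h : a.right ≠ y) :
    arr I a * idem I y = 0 := by
  rw [idem, arr, ← map_mul, vertex, arrow, path_mul_path_of_ne (by exact h), map_zero]

section Decomposition

variable [Fintype (Quiver.Total V)]

lemma exists_left_decomposition (x : BoundQuiverAlgebra I) :
    ∃ (l : V → k) (f : Quiver.Total V → BoundQuiverAlgebra I),
      x = ∑ y, l y • idem I y + ∑ c, arr I c * f c := by
  obtain ⟨x, rfl⟩ := toBound_surjective I x
  obtain ⟨l, f, rfl⟩ := exists_eq_sum_vertex_add_sum_arrow_mul x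
  exact ⟨l, fun c => toBound I (f c), by simp [idem, arr]⟩

variable {I}

lemma idem_mul_decomposition (l : V → k) (f : Quiver.Total V → BoundQuiverAlgebra I) (v : V) :
    idem I v * (∑ y, l y • idem I y + ∑ c, arr I c * f c) =
      l v • idem I v + ∑ c, idem I v * arr I c * f c := by
  rw [mul_add, Finset.mul_sum, Finset.mul_sum, Finset.sum_eq_single v _ (by simp)]
  · simp_rw [mul_assoc]
    rw [mul_smul_comm, idem_mul_idem]
  · intro y _ hy
    rw [mul_smul_comm, idem_mul_idem_of_ne I hy.symm, smul_zero]

namespace IsAlmostGentlePair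

variable (hI : IsAlmostGentlePair I)

include hI

/-- The terms for distinct arrows `c` are supported on paths with distinct first arrows, and
membership in `I` is decided path by path. This makes the sum of the right ideals of the arrows
direct. -/
lemma arr_mul_eq_zero_of_sum_eq_zero {l : V → k} {f : Quiver.Total V → BoundQuiverAlgebra I}
    (h : ∑ y, l y • idem I y + ∑ c, arr I c * f c = 0) (c : Quiver.Total V) :
    arr I c * f c = 0 := by
  choose g hg using fun c => toBound_surjective I (f c)
  have h' : ∑ y, l y • vertex k y + ∑ c, arrow k c * g c ∈ I := by
    rw [← toBound_eq_zero_iff, ← h]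
    simp [idem, arr, hg]
  rw [← hg, arr, ← map_mul, toBound_eq_zero_iff]
  refine mem_of_forall_hasRelation fun p hp => ?_
  obtain ⟨y, q, rfl⟩ := exists_of_coeff_arrow_mul_ne_zero hp
  exact hI.hasRelation_of_coeff_ne_zero h' (by rwa [coeff_decomposition_consLeft])

lemma arr_mul_eq_zero_of_family {ι : Type*} [Fintype ι] {c : ι → Quiver.Total V}
    (hc : Function.Injective c) {f : ι → BoundQuiverAlgebra I}
    (h : ∑ i, arr I (c i) * f i = 0) (i : ι) : arr I (c i) * f i = 0 := by
  classical
  -- The family is extended by zero to all arrows, with no vertex part.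
  have h' : ∑ y, (0 : V → k) y • idem I y + ∑ d, arr I d * Function.extend c f 0 d = 0 := by
    rw [← h]
    simp only [Pi.zero_apply, zero_smul, Finset.sum_const_zero, zero_add]
    refine (Fintype.sum_of_injective c hc _ _ ?_ ?_).symm
    · intro d hd
      rw [Function.extend_apply' _ _ _ (by simpa using hd)]
      simp
    · intro i
      rw [hc.extend_apply]
  simpa [hc.extend_apply] using hI.arr_mul_eq_zero_of_sum_eq_zero h' (c i)

/-- Determines the right annihilator of `b`: prefixing `b` to a path starting with `c` creates a new
relation only if `bc = 0`, and prefixing it to a trivial path creates none. -/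
lemma coeff_eq_zero_of_arr_mul_eq_zero {l : V → k} {f : Quiver.Total V → BoundQuiverAlgebra I}
    {b : Quiver.Total V} (h : arr I b * (∑ y, l y • idem I y + ∑ c, arr I c * f c) = 0) :
    l b.right = 0 ∧
      ∀ c, c.left = b.right → arr I b * arr I c ≠ 0 → arr I c * f c = 0 := by
  choose g hg using fun c => toBound_surjective I (f c)
  have h' : arrow k b * (∑ y, l y • vertex k y + ∑ c, arrow k c * g c) ∈ I := by
    rw [← toBound_eq_zero_iff, ← h]
    simp [idem, arr, hg]
  constructor
  · by_contra hl
    have := hI.hasRelation_of_coeff_ne_zero h' (p := consLeft b .nil)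
      (by rwa [coeff_arrow_mul, coeff_decomposition_nil])
    exact not_hasRelation_toPath _ this
  · intro c hbc hne
    rw [← hg, arr, ← map_mul, toBound_eq_zero_iff]
    refine mem_of_forall_hasRelation fun p hp => ?_
    obtain ⟨y, q, rfl⟩ := exists_of_coeff_arrow_mul_ne_zero hp
    obtain ⟨cl, cr, c⟩ := c
    subst hbc
    have := hI.hasRelation_of_coeff_ne_zero h' (p := consLeft b (c.toPath.comp q))
      (by rwa [coeff_arrow_mul, coeff_decomposition_consLeft _ _ ⟨_, _, c⟩])
    refine (HasRelation.of_comp this).resolve_right fun h => hne ?_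
    exact (arr_mul_arr_eq_zero_iff I).2 h

/-- Expand `x` by the last arrow of its paths. An arrow `d` with `cd = 0` kills the trivial path at
the target of `c`. For another arrow `c'` with the same target, choose `d` with `c'd ≠ 0`; then `cd
= 0` by `left_unique`, so `xd = 0`, and as `c'd` is no relation the terms ending in `c'` already
vanish. Only terms ending in `c` remain. -/
lemma exists_eq_mul_arr {c : Quiver.Total V} {x : BoundQuiverAlgebra I}
    (hx : x * idem I c.right = x)
    (hd : ∃ d : Quiver.Total V, d.left = c.right ∧ arr I c * arr I d = 0)
    (hxd : ∀ d : Quiver.Total V, d.left = c.right → arr I c * arr I d = 0 → x * arr I d = 0)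
    (hc : ∀ c' : Quiver.Total V, c'.right = c.right → c' ≠ c →
      ∃ d : Quiver.Total V, d.left = c.right ∧ arr I c' * arr I d ≠ 0) :
    ∃ y, x = y * arr I c := by
  obtain ⟨z, rfl⟩ := toBound_surjective I x
  obtain ⟨l, g, rfl⟩ := exists_eq_sum_vertex_add_sum_mul_arrow z
  have hxd' : ∀ d : Quiver.Total V, d.left = c.right → arr I c * arr I d = 0 →
      (∑ y, l y • vertex k y + ∑ c, g c * arrow k c) * arrow k d ∈ I := by
    intro d hd hcd
    rw [← toBound_eq_zero_iff, map_mul]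
    exact hxd d hd hcd
  have hl : l c.right = 0 := by
    obtain ⟨⟨dl, dr, d⟩, rfl, hcd⟩ := hd
    by_contra hl
    have := hI.hasRelation_of_coeff_ne_zero (hxd' _ rfl hcd) (p := consRight ⟨_, _, d⟩ .nil)
      (by rwa [coeff_mul_arrow, coeff_right_decomposition_nil])
    exact not_hasRelation_toPath d this
  have hg : ∀ c' : Quiver.Total V, c'.right = c.right → c' ≠ c →
      toBound I (g c' * arrow k c') = 0 := by
    intro c' hc' hne
    rw [toBound_eq_zero_iff]
    refine mem_of_forall_hasRelation fun p hp => ?_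
    obtain ⟨y, q, rfl⟩ := exists_of_coeff_mul_arrow_ne_zero hp
    obtain ⟨d, hd, hcd⟩ := hc c' hc' hne
    rw [ne_eq, arr_mul_arr_eq_zero_iff] at hcd
    have hcd' : arr I c * arr I d = 0 := by
      by_contra h
      rw [arr_mul_arr_eq_zero_iff] at h
      exact hne (hI.left_unique d c' c hcd h)
    have hmem := hxd' d hd hcd'
    obtain ⟨cl, cr, c'⟩ := c'
    obtain ⟨dl, dr, d⟩ := d
    obtain rfl : dl = cr := hd.trans hc'.symm
    -- The relation in the path `q c' d` cannot be the final `c'd`, so it already lies in `q c'`.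
    have := hI.hasRelation_of_coeff_ne_zero hmem (p := consRight ⟨_, _, d⟩ (q.cons c'))
      (by rwa [coeff_mul_arrow, coeff_decomposition_consRight _ _ ⟨_, _, c'⟩])
    exact (HasRelation.of_cons this).resolve_right hcd
  refine ⟨toBound I (g c), ?_⟩
  rw [← hx, map_add, add_mul, map_sum, map_sum, Finset.sum_mul, Finset.sum_mul,
    Finset.sum_eq_zero, zero_add, Finset.sum_eq_single c _ (by simp)]
  · rw [map_mul, mul_assoc]
    exact congrArg _ (arr_mul_idem I c)
  · intro c' _ hne
    by_cases h : c'.right = c.right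
    · rw [hg c' h hne, zero_mul]
    · rw [map_mul, mul_assoc]
      exact (congrArg _ (arr_mul_idem_of_ne I h)).trans (mul_zero _)
  · intro y _
    rw [map_smul, smul_mul_assoc]
    by_cases h : y = c.right
    · rw [h, hl, zero_smul]
    · exact (congrArg _ (idem_mul_idem_of_ne I h)).trans (smul_zero _)

end IsAlmostGentlePair

end Decomposition

namespace IsAlmostGentlePair

variable {I} (hI : IsAlmostGentlePair I)

include hI

lemma coeff_eq_of_toBound_eq {x y : PathAlgebra k V} (h : toBound I x = toBound I y)
    {p : PathOf V} (hp : ¬ HasRelation I p.2.2) : coeff x p = coeff y p := by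
  rw [← sub_eq_zero, ← coeff_sub]
  by_contra h'
  refine hp (hI.hasRelation_of_coeff_ne_zero ((toBound_eq_zero_iff I).1 ?_) h')
  rw [map_sub, h, sub_self]

/-- From `yc = c`, the trivial path at the common source has coefficient one in `y`, so `d` has
coefficient one in `yd`. -/
lemma mul_arr_ne_zero_of_mul_arr_eq_self {c d : Quiver.Total V} (h : c.left = d.left)
    {y : BoundQuiverAlgebra I} (hc : y * arr I c = arr I c) : y * arr I d ≠ 0 := by
  intro hd
  obtain ⟨y, rfl⟩ := toBound_surjective I y
  rw [arr, ← map_mul] at hc hd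
  rw [← map_zero (toBound I)] at hd
  have h₁ := hI.coeff_eq_of_toBound_eq hc (p := ⟨_, _, c.hom.toPath⟩) (not_hasRelation_toPath _)
  have h₂ := hI.coeff_eq_of_toBound_eq hd (p := ⟨_, _, d.hom.toPath⟩) (not_hasRelation_toPath _)
  rw [coeff_mul_arrow_toPath, arrow, coeff_path_self, h] at h₁
  rw [coeff_mul_arrow_toPath, h₁, coeff_zero] at h₂
  exact one_ne_zero h₂

lemma eq_of_arr_eq_mul_arr {c d : Quiver.Total V} {y : BoundQuiverAlgebra I}
    (h : arr I c = y * arr I d) : c = d := by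
  obtain ⟨y, rfl⟩ := toBound_surjective I y
  rw [arr, arr, ← map_mul] at h
  have h' := hI.coeff_eq_of_toBound_eq h (p := ⟨_, _, c.hom.toPath⟩) (not_hasRelation_toPath _)
  rw [arrow, coeff_path_self] at h'
  obtain ⟨z, q, hq⟩ := exists_of_coeff_mul_arrow_ne_zero (h' ▸ one_ne_zero)
  exact consRight_injective_arrow (p := .nil) hq

end IsAlmostGentlePair

end Algebra

/-! ### Right modules: projectives, finiteness and socle elements -/

section Modules

open PathAlgebra MulOpposite

universe u v w

/-- The right linear map from a ring to a right module that sends `1` to `m`. -/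
def ofElement {A : Type*} [Ring A] {M : Type*} [AddCommGroup M] [Module Aᵐᵒᵖ M] (m : M) :
    A →ₗ[Aᵐᵒᵖ] M where
  toFun x := op x • m
  map_add' x y := by rw [MulOpposite.op_add, add_smul]
  map_smul' r x := by
    rw [RingHom.id_apply, smul_smul]
    rfl

/-- The left multiplication by an element, as a map of right modules. -/
abbrev leftMul {A : Type*} [Ring A] (x : A) : A →ₗ[Aᵐᵒᵖ] A := ofElement x

/-- The principal right ideal generated by an element. -/
abbrev rightIdeal {A : Type*} [Ring A] (x : A) : Submodule Aᵐᵒᵖ A := (leftMul x).range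

lemma self_mem_rightIdeal {A : Type*} [Ring A] (x : A) : x ∈ rightIdeal x := ⟨1, mul_one x⟩

instance projective_self {A : Type*} [Ring A] : Module.Projective Aᵐᵒᵖ A :=
  .of_equiv (M := Aᵐᵒᵖ)
    ({ (MulOpposite.opAddEquiv (α := A)).symm with map_smul' := fun _ _ => rfl } :
      Aᵐᵒᵖ ≃ₗ[Aᵐᵒᵖ] A)

lemma projective_rightIdeal {A : Type*} [Ring A] {e : A} (he : e * e = e) :
    Module.Projective Aᵐᵒᵖ (rightIdeal e) := by
  refine Module.Projective.of_split (rightIdeal e).subtype (ofElement e).rangeRestrict ?_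
  ext ⟨_, z, rfl⟩
  change e * (e * z) = e * z
  rw [← mul_assoc, he]

lemma op_smul_op_smul {A : Type*} [Ring A] {M : Type*} [AddCommGroup M] [Module Aᵐᵒᵖ M] (x y : A)
    (m : M) : op y • op x • m = op (x * y) • m := by
  rw [smul_smul, MulOpposite.op_mul]

variable {k : Type u} {V : Type v} [Field k] [Quiver.{w} V]

lemma finite_setOf_length_lt [Finite V] [∀ x y : V, Finite (x ⟶ y)] (n : ℕ) :
    {p : PathOf V | p.length < n}.Finite := by
  induction n with
  | zero => simp
  | succ n ih =>
    have h₁ : (Set.range (nilPath (V := V))).Finite := Set.finite_range _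
    have := ih.to_subtype
    let F : (Σ p : {p : PathOf V | p.length < n}, Σ z : V, (p.1.2.1 ⟶ z)) → PathOf V :=
      fun t => ⟨t.1.1.1, t.2.1, t.1.1.2.2.cons t.2.2⟩
    refine (h₁.union (Set.finite_range F)).subset ?_
    rintro ⟨x, y, p⟩ hp
    obtain _ | ⟨p, a⟩ := p
    · exact .inl ⟨x, rfl⟩
    · exact .inr ⟨⟨⟨⟨x, _, p⟩, by simpa [PathOf.length] using hp⟩, _, a⟩, rfl⟩

instance finite_total [Finite V] [∀ x y : V, Finite (x ⟶ y)] : Finite (Quiver.Total V) :=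
  Finite.of_injective (fun a : Quiver.Total V => (⟨a.left, a.right, a.hom⟩ : Σ x y : V, (x ⟶ y)))
    fun a b h => by
      obtain ⟨al, ar, a⟩ := a
      obtain ⟨bl, br, b⟩ := b
      obtain ⟨rfl, h⟩ := Sigma.mk.inj_iff.1 h
      obtain ⟨rfl, h⟩ := Sigma.mk.inj_iff.1 (eq_of_heq h)
      exact congrArg _ (eq_of_heq h)

variable [Fintype V] {I : TwoSidedIdeal (PathAlgebra k V)}

namespace IsAlmostGentlePair

variable (hI : IsAlmostGentlePair I)

include hI

lemma moduleFinite [∀ x y : V, Finite (x ⟶ y)] : Module.Finite k (BoundQuiverAlgebra I) := by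
  obtain ⟨m, -, hm⟩ := hI.admissible.path_mem
  have hfin := (finite_setOf_length_lt (V := V) m).image (fun p => toBound I (path p))
  refine Module.finite_def.2 ⟨hfin.toFinset, ?_⟩
  rw [hfin.coe_toFinset, eq_top_iff]
  rintro x -
  obtain ⟨x, rfl⟩ := toBound_surjective I x
  induction x using induction_on with
  | zero => rw [map_zero]; exact Submodule.zero_mem _
  | add x y hx hy => rw [map_add]; exact Submodule.add_mem _ hx hy
  | smul_path c p =>
    rw [map_smul]
    refine Submodule.smul_mem _ _ ?_
    by_cases hp : p.length < m
    · exact Submodule.subset_span ⟨p, hp, rfl⟩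
    · rw [(toBound_eq_zero_iff I).2 (hm p (not_lt.1 hp))]
      exact Submodule.zero_mem _

omit hI in
lemma isArtinianRing_op [Module.Finite k (BoundQuiverAlgebra I)] :
    IsArtinianRing (BoundQuiverAlgebra I)ᵐᵒᵖ :=
  have : Module.Finite k (BoundQuiverAlgebra I)ᵐᵒᵖ :=
    Module.Finite.equiv (MulOpposite.opLinearEquiv k)
  IsArtinianRing.of_finite k _

/-- Otherwise a nonzero `s` could be multiplied by ever longer paths without vanishing, but long
paths lie in `I`. -/
lemma exists_socle_element {M : Type*} [AddCommGroup M] [Module (BoundQuiverAlgebra I)ᵐᵒᵖ M]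
    [Nontrivial M] :
    ∃ (y : V) (s : M), s ≠ 0 ∧ op (idem I y) • s = s ∧ ∀ a, op (arr I a) • s = 0 := by
  by_contra hcon
  push Not at hcon
  obtain ⟨s, hs⟩ := exists_ne (0 : M)
  obtain ⟨m, -, hm⟩ := hI.admissible.path_mem
  have key : ∀ n : ℕ, ∃ p : PathOf V, p.length = n ∧ op (toBound I (path p)) • s ≠ 0 := by
    intro n
    induction n with
    | zero =>
      by_contra! h
      refine hs ?_
      rw [← one_smul (BoundQuiverAlgebra I)ᵐᵒᵖ s, ← MulOpposite.op_one, ← map_one (toBound I), one_def, map_sum,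
        Finset.op_sum, Finset.sum_smul]
      exact Finset.sum_eq_zero fun y _ => h _ rfl
    | succ n ih =>
      obtain ⟨⟨x, y, p⟩, hp, h⟩ := ih
      obtain ⟨⟨al, ar, a⟩, ha⟩ := hcon y _ h (by
        rw [op_smul_op_smul, idem, ← map_mul, vertex, path_mul_path_of_eq, Quiver.Path.comp_nil])
      rw [op_smul_op_smul, arr, ← map_mul] at ha
      by_cases hy : y = al
      · subst hy
        rw [path_mul_arrow ⟨_, _, a⟩ p] at ha
        exact ⟨_, congrArg (· + 1) hp, ha⟩
      · rw [arrow, path_mul_path_of_ne (by exact hy), map_zero, MulOpposite.op_zero, zero_smul] at ha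
        exact absurd rfl ha
  obtain ⟨p, hp, h⟩ := key m
  refine h ?_
  rw [(toBound_eq_zero_iff I).2 (hm p hp.ge), MulOpposite.op_zero, zero_smul]

end IsAlmostGentlePair

end Modules

/-! ### First syzygies that are direct sums of right ideals of arrows -/

section Syzygies

open PathAlgebra MulOpposite Abelian

universe u v w

variable {k : Type u} {V : Type v} [Field k] [Quiver.{w} V] [Fintype V]

/-- The module `M`, generated by `m`, is a quotient of the projective module of the vertex `y`,
and the kernel of the quotient map is the sum of the right ideals generated by the arrows `c i`. -/
structure IsPresentation (I : TwoSidedIdeal (PathAlgebra k V)) {ι : Type} [Fintype ι]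
    (c : ι → Quiver.Total V) (y : V) {M : Type (max u v w)} [AddCommGroup M]
    [Module (BoundQuiverAlgebra I)ᵐᵒᵖ M] (m : M) : Prop where
  injective : Function.Injective c
  left : ∀ i, (c i).left = y
  idem_smul : op (idem I y) • m = m
  generates : ∀ z : M, ∃ x : BoundQuiverAlgebra I, op x • m = z
  arr_smul : ∀ i, op (arr I (c i)) • m = 0
  ker : ∀ x : BoundQuiverAlgebra I, op x • m = 0 →
    ∃ f : ι → BoundQuiverAlgebra I, idem I y * x = ∑ i, arr I (c i) * f i

variable {I : TwoSidedIdeal (PathAlgebra k V)} {ι : Type} [Fintype ι]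
  {c : ι → Quiver.Total V} {y : V} {M : Type (max u v w)} [AddCommGroup M]
  [Module (BoundQuiverAlgebra I)ᵐᵒᵖ M] {m : M}

namespace IsPresentation

variable (h : IsPresentation I c y m)

include h

/-- The inclusion of the first syzygy. -/
noncomputable def syzygyMap : (∀ i, rightIdeal (arr I (c i))) →ₗ[(BoundQuiverAlgebra I)ᵐᵒᵖ]
    rightIdeal (idem I y) :=
  (∑ i, (rightIdeal (arr I (c i))).subtype ∘ₗ LinearMap.proj i).codRestrict _ fun x => by
    rw [LinearMap.sum_apply]
    refine Submodule.sum_mem _ fun i _ => ?_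
    obtain ⟨z, hz⟩ := (x i).2
    refine ⟨arr I (c i) * z, ?_⟩
    change idem I y * (arr I (c i) * z) = _
    rw [← h.left i, ← mul_assoc, idem_mul_arr]
    exact hz

lemma coe_syzygyMap (x : ∀ i, rightIdeal (arr I (c i))) :
    (h.syzygyMap x : BoundQuiverAlgebra I) = ∑ i, (x i : BoundQuiverAlgebra I) := by
  simp [syzygyMap]

lemma syzygyMap_injective (hI : IsAlmostGentlePair I) [Finite (Quiver.Total V)] :
    Function.Injective h.syzygyMap := by
  have := Fintype.ofFinite (Quiver.Total V)
  rw [injective_iff_map_eq_zero]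
  intro x hx
  choose f hf using fun i => (x i).2
  have hx' := congrArg Subtype.val hx
  rw [h.coe_syzygyMap] at hx'
  simp_rw [← hf] at hx'
  funext i
  refine Subtype.ext ?_
  rw [← hf]
  exact hI.arr_mul_eq_zero_of_family h.injective hx' i

/-- The quotient map from the projective module of the vertex. -/
noncomputable def coverMap (_ : IsPresentation I c y m) :
    rightIdeal (idem I y) →ₗ[(BoundQuiverAlgebra I)ᵐᵒᵖ] M :=
  ofElement m ∘ₗ (rightIdeal (idem I y)).subtype

lemma coverMap_surjective : Function.Surjective h.coverMap := by
  intro z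
  obtain ⟨x, rfl⟩ := h.generates z
  refine ⟨⟨idem I y * x, x, rfl⟩, ?_⟩
  change op (idem I y * x) • m = _
  rw [← op_smul_op_smul, h.idem_smul]

lemma exact_syzygyMap_coverMap : Function.Exact h.syzygyMap h.coverMap := by
  rintro ⟨z, hz⟩
  constructor
  · intro hx
    obtain ⟨f, hf⟩ := h.ker z hx
    refine ⟨fun i => ⟨arr I (c i) * f i, f i, rfl⟩, Subtype.ext ?_⟩
    rw [h.coe_syzygyMap]
    obtain ⟨x, rfl⟩ := hz
    change ∑ i, arr I (c i) * f i = idem I y * x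
    rw [← hf]
    change idem I y * (idem I y * x) = _
    rw [← mul_assoc, idem_mul_idem]
  · rintro ⟨x, hx⟩
    rw [← hx]
    change op (h.syzygyMap x : BoundQuiverAlgebra I) • m = 0
    rw [h.coe_syzygyMap, Finset.op_sum, Finset.sum_smul]
    refine Finset.sum_eq_zero fun i _ => ?_
    obtain ⟨f, hf⟩ := (x i).2
    rw [← hf]
    change op (arr I (c i) * f) • m = 0
    rw [← op_smul_op_smul, h.arr_smul, smul_zero]

/-- The short exact sequence of the first syzygy. -/
noncomputable abbrev shortComplex : ShortComplex (ModuleCat.{max u v w} (BoundQuiverAlgebra I)ᵐᵒᵖ) :=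
  ModuleCat.shortComplexOfCompEqZero h.syzygyMap h.coverMap
    h.exact_syzygyMap_coverMap.linearMap_comp_eq_zero

lemma shortExact (hI : IsAlmostGentlePair I) [Finite (Quiver.Total V)] :
    h.shortComplex.ShortExact :=
  ModuleCat.shortComplex_shortExact _ h.exact_syzygyMap_coverMap (h.syzygyMap_injective hI)
    h.coverMap_surjective

lemma projective_shortComplex : Projective h.shortComplex.X₂ := by
  have := projective_rightIdeal (idem_mul_idem I y)
  exact ModuleCat.projective_of_categoryTheory_projective 
    (ModuleCat.of (BoundQuiverAlgebra I)ᵐᵒᵖ (rightIdeal (idem I y)))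

variable (hI : IsAlmostGentlePair I) [Finite (Quiver.Total V)]

include hI

lemma subsingleton_ext_succ (Y : ModuleCat.{max u v w} (BoundQuiverAlgebra I)ᵐᵒᵖ) (n : ℕ)
    (hn : ∀ i, Subsingleton (Ext (ModuleCat.of _ (rightIdeal (arr I (c i)))) Y n)) :
    Subsingleton (Ext (ModuleCat.of _ M) Y (n + 1)) :=
  have := h.projective_shortComplex
  subsingleton_ext_succ_of_shortExact (h.shortExact hI) Y n (subsingleton_ext_pi _ n hn)

lemma subsingleton_ext_arr (Y : ModuleCat.{max u v w} (BoundQuiverAlgebra I)ᵐᵒᵖ) (n : ℕ)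
    (hn : Subsingleton (Ext (ModuleCat.of _ M) Y (n + 2))) (i : ι) :
    Subsingleton (Ext (ModuleCat.of _ (rightIdeal (arr I (c i)))) Y (n + 1)) :=
  have := h.projective_shortComplex
  subsingleton_ext_of_pi (fun i => rightIdeal (arr I (c i))) (n + 1)
    (subsingleton_ext_of_shortExact_succ (h.shortExact hI) Y n hn) i

/-- The maps `f i` form one map on the syzygy. It extends to the projective of `y`, and the image of
the idempotent under the extension is the common left factor. -/
lemma exists_mul_of_subsingleton_ext_one
    (h₁ : Subsingleton (Ext (ModuleCat.of (BoundQuiverAlgebra I)ᵐᵒᵖ M)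
      (ModuleCat.of (BoundQuiverAlgebra I)ᵐᵒᵖ (BoundQuiverAlgebra I)) 1))
    (f : ∀ i, rightIdeal (arr I (c i)) →ₗ[(BoundQuiverAlgebra I)ᵐᵒᵖ] BoundQuiverAlgebra I) :
    ∃ x, ∀ i, f i ⟨arr I (c i), self_mem_rightIdeal _⟩ = x * arr I (c i) := by
  classical
  obtain ⟨g, hg⟩ := exists_extension_of_subsingleton_ext_one (h.shortExact hI) _ h₁
    (ModuleCat.ofHom (∑ i, f i ∘ₗ LinearMap.proj i))
  refine ⟨g.hom ⟨idem I y, self_mem_rightIdeal _⟩, fun i => ?_⟩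
  have hgi := LinearMap.congr_fun (ModuleCat.hom_ext_iff.1 hg)
    (Pi.single i ⟨arr I (c i), self_mem_rightIdeal _⟩)
  change g.hom (h.syzygyMap _) = (∑ i, f i ∘ₗ LinearMap.proj i) _ at hgi
  have hs : h.syzygyMap (Pi.single i ⟨arr I (c i), self_mem_rightIdeal _⟩) =
      op (arr I (c i)) • ⟨idem I y, self_mem_rightIdeal _⟩ := by
    refine Subtype.ext ?_
    rw [h.coe_syzygyMap, Finset.sum_eq_single i _ (by simp)]
    · rw [Pi.single_eq_same]
      change _ = idem I y * arr I (c i)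
      rw [← h.left i, idem_mul_arr]
    · intro j _ hj
      rw [Pi.single_eq_of_ne hj]
      rfl
  rw [hs, map_smul, LinearMap.sum_apply, Finset.sum_eq_single i _ (by simp)] at hgi
  · simpa using hgi.symm
  · intro j _ hj
    simp [Pi.single_eq_of_ne hj]

lemma subsingleton_ext_one_of_exists_mul
    (hf : ∀ f : ∀ i, rightIdeal (arr I (c i)) →ₗ[(BoundQuiverAlgebra I)ᵐᵒᵖ] BoundQuiverAlgebra I,
      ∃ x, ∀ i, f i ⟨arr I (c i), self_mem_rightIdeal _⟩ = x * arr I (c i)) :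
    Subsingleton (Ext (ModuleCat.of (BoundQuiverAlgebra I)ᵐᵒᵖ M)
      (ModuleCat.of (BoundQuiverAlgebra I)ᵐᵒᵖ (BoundQuiverAlgebra I)) 1) := by
  classical
  have := h.projective_shortComplex
  refine subsingleton_ext_one_of_exists_extension (h.shortExact hI) _ fun f => ?_
  obtain ⟨x, hx⟩ := hf fun i => f.hom ∘ₗ
    LinearMap.single (BoundQuiverAlgebra I)ᵐᵒᵖ (fun i => rightIdeal (arr I (c i))) i
  refine ⟨ModuleCat.ofHom (ofElement x ∘ₗ (rightIdeal (idem I y)).subtype), ?_⟩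
  refine ModuleCat.hom_ext (LinearMap.pi_ext' fun i => ?_)
  refine LinearMap.ext ?_
  rintro ⟨_, z, rfl⟩
  have hz := congrArg (fun t : BoundQuiverAlgebra I => op z • t) (hx i)
  rw [← map_smul] at hz
  have hs : (h.syzygyMap (Pi.single i ⟨ofElement (arr I (c i)) z, z, rfl⟩) :
      BoundQuiverAlgebra I) = arr I (c i) * z := by
    rw [h.coe_syzygyMap, Finset.sum_eq_single i _ (by simp)]
    · rw [Pi.single_eq_same]
      rfl
    · intro j _ hj
      rw [Pi.single_eq_of_ne hj]
      rfl
  change x * (h.syzygyMap (Pi.single i ⟨ofElement (arr I (c i)) z, z, rfl⟩) :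
      BoundQuiverAlgebra I) = f.hom (Pi.single i ⟨ofElement (arr I (c i)) z, z, rfl⟩)
  rw [hs, ← mul_assoc]
  exact hz.symm

end IsPresentation

end Syzygies

/-! ### Vanishing of `Ext` for right ideals of arrows -/

section Criterion

open PathAlgebra MulOpposite Abelian

universe u v w

variable {k : Type u} {V : Type v} [Field k] [Quiver.{w} V] [Fintype V]
  (I : TwoSidedIdeal (PathAlgebra k V))

/-- The arrow `c` starts where `b` ends, and `b c` is zero in the bound quiver algebra. -/
def ZeroRelation (b c : Quiver.Total V) : Prop := c.left = b.right ∧ arr I b * arr I c = 0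

/-- The vanishing of `Ext ^ n (b A, A)`, for an arrow `b`. -/
def ExtVanishes (b : Quiver.Total V) (n : ℕ) : Prop :=
  Subsingleton (Ext (ModuleCat.of (BoundQuiverAlgebra I)ᵐᵒᵖ (rightIdeal (arr I b)))
    (ModuleCat.of (BoundQuiverAlgebra I)ᵐᵒᵖ (BoundQuiverAlgebra I)) n)

lemma exists_finite_family {X : Type*} [Finite X] (T : X → Prop) :
    ∃ (n : ℕ) (c : Fin n → X), Function.Injective c ∧ ∀ d, T d ↔ ∃ i, c i = d := by
  obtain ⟨n, ⟨e⟩⟩ := Finite.exists_equiv_fin {x // T x}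
  refine ⟨n, fun i => e.symm i, Subtype.val_injective.comp e.symm.injective, fun d => ⟨fun hd =>
    ⟨e ⟨d, hd⟩, by simp⟩, ?_⟩⟩
  rintro ⟨i, rfl⟩
  exact (e.symm i).2

variable {I}

/-- The common form of the kernel condition for the presentations of `bA` and of simple modules. -/
lemma idem_mul_eq_sum_family {ι : Type} [Fintype ι] {c : ι → Quiver.Total V}
    (hc : Function.Injective c) {y : V} [Fintype (Quiver.Total V)] {l : V → k}
    {f : Quiver.Total V → BoundQuiverAlgebra I} (hl : l y = 0)
    (hf : ∀ d, d.left = y → (∀ i, c i ≠ d) → arr I d * f d = 0) (hy : ∀ i, (c i).left = y) :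
    idem I y * (∑ z, l z • idem I z + ∑ d, arr I d * f d) = ∑ i, arr I (c i) * f (c i) := by
  rw [idem_mul_decomposition, hl, zero_smul, zero_add]
  refine (Fintype.sum_of_injective c hc _ _ ?_ ?_).symm
  · intro d hd
    by_cases h : d.left = y
    · rw [← h, idem_mul_arr]
      exact hf d h fun i hi => hd ⟨i, hi⟩
    · rw [idem_mul_arr_of_ne I (Ne.symm h), zero_mul]
  · intro i
    rw [← hy i, idem_mul_arr]

variable [Finite (Quiver.Total V)]

namespace IsAlmostGentlePair

variable (hI : IsAlmostGentlePair I)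

include hI

lemma isPresentation_arr {ι : Type} [Fintype ι] {c : ι → Quiver.Total V}
    (hc : Function.Injective c) {b : Quiver.Total V} (hb : ∀ d, ZeroRelation I b d ↔ ∃ i, c i = d) :
    IsPresentation I c b.right (⟨arr I b, self_mem_rightIdeal _⟩ : rightIdeal (arr I b)) where
  injective := hc
  left i := ((hb _).2 ⟨i, rfl⟩).1
  idem_smul := Subtype.ext (arr_mul_idem I b)
  generates := by
    rintro ⟨_, x, rfl⟩
    exact ⟨x, rfl⟩
  arr_smul i := Subtype.ext ((hb _).2 ⟨i, rfl⟩).2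
  ker x hx := by
    have := Fintype.ofFinite (Quiver.Total V)
    obtain ⟨l, f, rfl⟩ := exists_left_decomposition I x
    obtain ⟨hl, hf⟩ := hI.coeff_eq_zero_of_arr_mul_eq_zero (congrArg Subtype.val hx)
    refine ⟨_, idem_mul_eq_sum_family hc hl (fun d hd hd' => hf d hd fun h => ?_)
      fun i => ((hb _).2 ⟨i, rfl⟩).1⟩
    obtain ⟨i, hi⟩ := (hb d).1 ⟨hd, h⟩
    exact hd' i hi

omit hI in
lemma _root_.AlmostGentle.isPresentation_simple {ι : Type} [Fintype ι] {c : ι → Quiver.Total V}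
    (hc : Function.Injective c) {y : V} (hy : ∀ d : Quiver.Total V, d.left = y ↔ ∃ i, c i = d)
    {M : Type (max u v w)} [AddCommGroup M] [Module (BoundQuiverAlgebra I)ᵐᵒᵖ M]
    [IsSimpleModule (BoundQuiverAlgebra I)ᵐᵒᵖ M] {s : M} (hs : s ≠ 0)
    (hys : op (idem I y) • s = s) (has : ∀ a, op (arr I a) • s = 0) :
    IsPresentation I c y s where
  injective := hc
  left i := (hy _).2 ⟨i, rfl⟩
  idem_smul := hys
  generates z := by
    obtain ⟨x, hx⟩ := IsSimpleModule.toSpanSingleton_surjective (BoundQuiverAlgebra I)ᵐᵒᵖ hs z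
    exact ⟨x.unop, hx⟩
  arr_smul i := has _
  ker x hx := by
    have := Fintype.ofFinite (Quiver.Total V)
    obtain ⟨l, f, rfl⟩ := exists_left_decomposition I x
    refine ⟨_, idem_mul_eq_sum_family hc ?_ (fun d hd hd' => ?_) fun i => (hy _).2 ⟨i, rfl⟩⟩
    · by_contra hl
      rw [← hys, op_smul_op_smul, idem_mul_decomposition, MulOpposite.op_add, add_smul,
        Finset.op_sum, Finset.sum_smul, Finset.sum_eq_zero, add_zero] at hx
      · refine hs ?_
        -- A nonzero coefficient `l y` can be inverted, so the vanishing of `l y` times `s` would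
        -- give `s = 0`.
        have he : idem I y = (l y • idem I y) * ((l y)⁻¹ • 1) := by
          rw [mul_smul_comm, mul_one, inv_smul_smul₀ hl]
        rw [← hys, he, ← op_smul_op_smul, hx, smul_zero]
      · intro d _
        by_cases h : y = d.left
        · rw [h, idem_mul_arr, ← op_smul_op_smul, has, smul_zero]
        · rw [idem_mul_arr_of_ne I h, zero_mul, MulOpposite.op_zero, zero_smul]
    · obtain ⟨i, hi⟩ := (hy d).1 hd
      exact absurd hi (hd' i)

lemma extVanishes_succ {b : Quiver.Total V} {n : ℕ}
    (h : ∀ c, ZeroRelation I b c → ExtVanishes I c n) : ExtVanishes I b (n + 1) := by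
  obtain ⟨m, c, hc, hb⟩ := exists_finite_family (ZeroRelation I b)
  exact (hI.isPresentation_arr hc hb).subsingleton_ext_succ hI _ n
    fun i => h _ ((hb _).2 ⟨i, rfl⟩)

lemma extVanishes_of_zeroRelation {b d : Quiver.Total V} {n : ℕ} (h : ExtVanishes I b (n + 2))
    (hbd : ZeroRelation I b d) : ExtVanishes I d (n + 1) := by
  obtain ⟨m, c, hc, hb⟩ := exists_finite_family (ZeroRelation I b)
  obtain ⟨i, rfl⟩ := (hb d).1 hbd
  exact (hI.isPresentation_arr hc hb).subsingleton_ext_arr hI _ n h i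

/-- There is a map from the right ideal of an arrow with a prescribed value at the arrow, as soon as
the value satisfies the relations of the arrow. -/
lemma exists_linearMap_arr {c : Quiver.Total V} {z : BoundQuiverAlgebra I}
    (hz : z * idem I c.right = z) (hd : ∀ d, ZeroRelation I c d → z * arr I d = 0) :
    ∃ f : rightIdeal (arr I c) →ₗ[(BoundQuiverAlgebra I)ᵐᵒᵖ] BoundQuiverAlgebra I,
      f ⟨arr I c, self_mem_rightIdeal _⟩ = z := by
  obtain ⟨m, d, hinj, hdc⟩ := exists_finite_family (ZeroRelation I c)
  have hker : (leftMul (arr I c)).ker ≤ (leftMul z).ker := by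
    intro x hx
    obtain ⟨g, hg⟩ := (hI.isPresentation_arr hinj hdc).ker x (Subtype.ext hx)
    change z * x = 0
    rw [← hz, mul_assoc, hg, Finset.mul_sum]
    refine Finset.sum_eq_zero fun i _ => ?_
    rw [← mul_assoc, hd _ ((hdc _).2 ⟨i, rfl⟩), zero_mul]
  refine ⟨(leftMul (arr I c)).ker.liftQ (leftMul z) hker ∘ₗ
    (leftMul (arr I c)).quotKerEquivRange.symm.toLinearMap, ?_⟩
  have h : (⟨arr I c, self_mem_rightIdeal _⟩ : rightIdeal (arr I c)) =
      (leftMul (arr I c)).quotKerEquivRange (Submodule.Quotient.mk 1) :=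
    Subtype.ext (mul_one _).symm
  rw [LinearMap.comp_apply, h, LinearEquiv.coe_coe, LinearEquiv.symm_apply_apply]
  exact mul_one z

/-- If `Ext ^ 1 (b A, A) = 0`, then elements satisfying the relations of the arrows following `b`
are simultaneous left multiples of these arrows. -/
lemma exists_mul_of_extVanishes_one {b : Quiver.Total V} (h : ExtVanishes I b 1)
    (z : Quiver.Total V → BoundQuiverAlgebra I)
    (hz : ∀ c, ZeroRelation I b c → z c * idem I c.right = z c)
    (hd : ∀ c, ZeroRelation I b c → ∀ d, ZeroRelation I c d → z c * arr I d = 0) :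
    ∃ x, ∀ c, ZeroRelation I b c → z c = x * arr I c := by
  obtain ⟨m, c, hc, hb⟩ := exists_finite_family (ZeroRelation I b)
  have hi : ∀ i, ZeroRelation I b (c i) := fun i => (hb _).2 ⟨i, rfl⟩
  choose f hf using fun i => hI.exists_linearMap_arr (hz _ (hi i)) (hd _ (hi i))
  obtain ⟨x, hx⟩ := (hI.isPresentation_arr hc hb).exists_mul_of_subsingleton_ext_one hI h f
  refine ⟨x, fun d hbd => ?_⟩
  obtain ⟨i, rfl⟩ := (hb d).1 hbd
  rw [← hx, hf]

/-- If `Ext ^ 1 (b A, A) = 0`, at most one arrow `c` satisfies `b c = 0`. -/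
lemma zeroRelation_unique_of_extVanishes {b c d : Quiver.Total V} (h : ExtVanishes I b 1)
    (hc : ZeroRelation I b c) (hd : ZeroRelation I b d) : c = d := by
  classical
  by_contra hne
  -- The test family is the inclusion on `cA` and zero on the other summands: `xc = c` and `xd = 0`
  -- are incompatible.
  obtain ⟨x, hx⟩ := hI.exists_mul_of_extVanishes_one h (Pi.single c (arr I c))
    (fun a _ => by
      by_cases h : a = c
      · subst h; rw [Pi.single_eq_same, arr_mul_idem]
      · rw [Pi.single_eq_of_ne h, zero_mul])
    (fun a _ e he => by
      by_cases h : a = c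
      · subst h; rw [Pi.single_eq_same, he.2]
      · rw [Pi.single_eq_of_ne h, zero_mul])
  have h₁ := hx c hc
  have h₂ := hx d hd
  rw [Pi.single_eq_same] at h₁
  rw [Pi.single_eq_of_ne (Ne.symm hne)] at h₂
  exact hI.mul_arr_ne_zero_of_mul_arr_eq_self (hc.1.trans hd.1.symm) h₁.symm h₂.symm

/-- If `Ext ^ 1 (b A, A) = 0` and `b c = 0`, then every other arrow ending where `c` ends has a
nonzero product with an arrow. -/
lemma exists_mul_ne_zero_of_extVanishes {b c c' : Quiver.Total V} (h : ExtVanishes I b 1)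
    (hc : ZeroRelation I b c) (hne : c' ≠ c) (hr : c'.right = c.right) :
    ∃ d, d.left = c.right ∧ arr I c' * arr I d ≠ 0 := by
  by_contra! hcon
  have huniq : ∀ a, ZeroRelation I b a → a = c := fun a ha =>
    hI.zeroRelation_unique_of_extVanishes h ha hc
  -- If `c'` annihilates every arrow starting at its target, then `c ↦ c'` respects the relations of
  -- `c`, which yields `c' = xc`.
  obtain ⟨x, hx⟩ := hI.exists_mul_of_extVanishes_one h (fun _ => arr I c')
    (fun a ha => by rw [huniq a ha, ← hr, arr_mul_idem])
    (fun a ha d hd => hcon d (by rw [hd.1, huniq a ha]))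
  exact hne (hI.eq_of_arr_eq_mul_arr (hx c hc))

/-- The syzygy of `bA` is zero or `cA`. In the second case the image of `c` under any map to `A` is
annihilated by every `d` with `cd = 0`, so `exists_eq_mul_arr` makes it a left multiple of `c`. -/
lemma extVanishes_one {b c : Quiver.Total V} (huniq : ∀ a, ZeroRelation I b a → a = c)
    (hd : ∃ d, ZeroRelation I c d)
    (hc : ∀ c' : Quiver.Total V, c'.right = c.right → c' ≠ c →
      ∃ d : Quiver.Total V, d.left = c.right ∧ arr I c' * arr I d ≠ 0) : ExtVanishes I b 1 := by
  have := Fintype.ofFinite (Quiver.Total V)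
  obtain ⟨m, g, hg, hb⟩ := exists_finite_family (ZeroRelation I b)
  have hi : ∀ i, g i = c := fun i => huniq _ ((hb _).2 ⟨i, rfl⟩)
  refine (hI.isPresentation_arr hg hb).subsingleton_ext_one_of_exists_mul hI fun f => ?_
  by_cases hm : Nonempty (Fin m)
  swap
  · exact ⟨0, fun i => absurd ⟨i⟩ hm⟩
  obtain ⟨i⟩ := hm
  have hmul : ∀ z : BoundQuiverAlgebra I, f i ⟨arr I (g i), self_mem_rightIdeal _⟩ * z =
      f i ⟨arr I (g i) * z, z, rfl⟩ := fun z =>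
    ((f i).map_smul (op z) ⟨arr I (g i), self_mem_rightIdeal _⟩).symm
  obtain ⟨x, hx⟩ := hI.exists_eq_mul_arr (c := c)
    (x := f i ⟨arr I (g i), self_mem_rightIdeal _⟩)
    (by
      rw [hmul]
      congr 1
      exact Subtype.ext (by change arr I (g i) * _ = arr I (g i); rw [hi, arr_mul_idem]))
    hd
    (fun d _ hcd => by
      rw [hmul, ← (f i).map_zero]
      congr 1
      exact Subtype.ext (by change arr I (g i) * _ = 0; rw [hi, hcd]))
    hc
  refine ⟨x, fun j => ?_⟩
  obtain rfl : j = i := hg ((hi j).trans (hi i).symm)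
  rw [hx, hi]

/-- A simple module is generated by a socle element at some vertex, and its first syzygy is a sum of
right ideals `cA`; this raises the degree from `n` to `n + 1`. -/
lemma hasInjectiveDimensionLE [∀ x y : V, Finite (x ⟶ y)] {n : ℕ}
    (h : ∀ c : Quiver.Total V, ExtVanishes I c n) :
    HasInjectiveDimensionLE
      (ModuleCat.of (BoundQuiverAlgebra I)ᵐᵒᵖ (BoundQuiverAlgebra I)) n := by
  have := hI.moduleFinite
  have := isArtinianRing_op (I := I)
  refine hasInjectiveDimensionLE_of_subsingleton_ext_simple _ n fun M _ _ _ => ?_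
  have := IsSimpleModule.nontrivial (BoundQuiverAlgebra I)ᵐᵒᵖ M
  obtain ⟨y, s, hs, hys, has⟩ := hI.exists_socle_element (M := M)
  obtain ⟨m, c, hc, hy⟩ := exists_finite_family fun d : Quiver.Total V => d.left = y
  exact (isPresentation_simple hc hy hs hys has).subsingleton_ext_succ hI _ n fun i => h (c i)

end IsAlmostGentlePair

end Criterion

/-! ### Forbidden cycles and finiteness of the injective dimension -/

section ForbiddenCycles

open PathAlgebra Abelian

universe u v w

lemma exists_chain_of_transGen {X : Type*} {r : X → X → Prop} {b c : X}
    (h : Relation.TransGen r b c) : ∃ (n : ℕ) (f : ℕ → X), 0 < n ∧ f 0 = b ∧ f n = c ∧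
      ∀ i < n, r (f i) (f (i + 1)) := by
  induction h with
  | @single c h =>
    refine ⟨1, fun i => if i = 0 then b else c, one_pos, rfl, rfl, fun i hi => ?_⟩
    obtain rfl : i = 0 := by lia
    exact h
  | @tail c d _ h ih =>
    obtain ⟨n, f, hn, h0, hc, hf⟩ := ih
    refine ⟨n + 1, fun i => if i ≤ n then f i else d, n.succ_pos, by simpa, by simp,
      fun i hi => ?_⟩
    obtain hi | rfl := Nat.lt_succ_iff_lt_or_eq.1 hi
    · simpa [hi.le, Nat.succ_le_iff.2 hi] using hf i hi
    · simpa [hc] using h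

variable {k : Type u} {V : Type v} [Field k] [Quiver.{w} V] [Fintype V]
  {I : TwoSidedIdeal (PathAlgebra k V)}

lemma zeroRelation_iff {b c : Quiver.Total V} :
    ZeroRelation I b c ↔ c.left = b.right ∧ arrow k b * arrow k c ∈ I := by
  rw [ZeroRelation, arr_mul_arr_eq_zero_iff]

lemma exists_forbiddenCycle {b : Quiver.Total V} (h : Relation.TransGen (ZeroRelation I) b b) :
    ∃ C : ForbiddenCycle I, C.a 0 = b := by
  obtain ⟨n, f, hn, h0, hb, hf⟩ := exists_chain_of_transGen h
  have : NeZero n := ⟨hn.ne'⟩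
  have key : ∀ i : ZMod n, ZeroRelation I (f i.val) (f (i + 1).val) := by
    intro i
    have h₁ : i + 1 = ((i.val + 1 : ℕ) : ZMod n) := by simp
    rw [h₁, ZMod.val_natCast]
    have hi := i.val_lt
    -- At the last index the successor wraps around to `0`, which is harmless because `f 0 = f n =
    -- b`.
    have h₂ : f ((i.val + 1) % n) = f (i.val + 1) := by
      obtain h | h := (Nat.succ_le_of_lt hi).lt_or_eq
      · rw [Nat.mod_eq_of_lt h]
      · rw [Nat.succ_eq_add_one] at h
        rw [h, Nat.mod_self, h0, hb]
    rw [h₂]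
    exact hf _ hi
  exact ⟨⟨n, hn, fun i => f i.val, fun i => (key i).1.symm, fun i => (zeroRelation_iff.1 (key i)).2⟩,
    by simpa⟩

lemma ForbiddenCycle.zeroRelation (C : ForbiddenCycle I) (i : ZMod C.len) :
    ZeroRelation I (C.a i) (C.a (i + 1)) :=
  zeroRelation_iff.2 ⟨(C.target_eq_source i).symm, C.mul_mem i⟩

lemma ForbiddenCycle.zeroRelation_sub_one (C : ForbiddenCycle I) (i : ZMod C.len) :
    ZeroRelation I (C.a (i - 1)) (C.a i) := by
  simpa using C.zeroRelation (i - 1)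

namespace IsAlmostGentlePair

variable (hI : IsAlmostGentlePair I)

include hI

section Finite

variable [Finite (Quiver.Total V)]

/-- Each step forward along the cycle lowers the degree by one, and every arrow of the cycle has a
predecessor on it. -/
lemma extVanishes_one_of_forbiddenCycle (C : ForbiddenCycle I) {n : ℕ}
    (h : ∀ i, ExtVanishes I (C.a i) (n + 1)) (i : ZMod C.len) : ExtVanishes I (C.a i) 1 := by
  induction n with
  | zero => exact h i
  | succ n ih =>
    exact ih fun j => hI.extVanishes_of_zeroRelation (h (j - 1)) (C.zeroRelation_sub_one j)

lemma not_condition_of_extVanishes (C : ForbiddenCycle I) {n : ℕ}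
    (h : ∀ i, ExtVanishes I (C.a i) (n + 1)) (i : ZMod C.len) :
    ¬ (C.ConditionA i ∨ C.ConditionB i) := by
  have h₁ := hI.extVanishes_one_of_forbiddenCycle C h
  have hc := C.zeroRelation_sub_one i
  rintro (⟨a, ha, hne, hmem⟩ | ⟨b, hb, hne, hmem⟩)
  -- With `b = a_{i-2}` and `c = a_{i-1}`, the arrow `a` of condition (A) has some `d` with `ad ≠
  -- 0`. Then `a_{i-1} d = 0` by `left_unique`, so `d = a_i` by uniqueness, against `a a_i ∈ I`.
  · obtain ⟨d, hd, had⟩ := hI.exists_mul_ne_zero_of_extVanishes (h₁ (i - 1 - 1))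
      (C.zeroRelation_sub_one (i - 1)) hne (ha.trans hc.1)
    rw [ne_eq, arr_mul_arr_eq_zero_iff] at had
    have hcd : ZeroRelation I (C.a (i - 1)) d := by
      refine zeroRelation_iff.2 ⟨hd, ?_⟩
      by_contra hcd
      exact hne (hI.left_unique d a _ had hcd)
    rw [hI.zeroRelation_unique_of_extVanishes (h₁ (i - 1)) hcd hc] at had
    exact had hmem
  · exact hne (hI.zeroRelation_unique_of_extVanishes (h₁ (i - 1))
      (zeroRelation_iff.2 ⟨hb.trans hc.1, hmem⟩) hc)

variable (hno : ∀ (C : ForbiddenCycle I) (i : ZMod C.len), ¬ (C.ConditionA i ∨ C.ConditionB i))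

include hno

omit hI [Finite (Quiver.Total V)] in
lemma _root_.AlmostGentle.ForbiddenCycle.eq_of_zeroRelation (C : ForbiddenCycle I)
    {i : ZMod C.len} {c : Quiver.Total V} (h : ZeroRelation I (C.a i) c) : c = C.a (i + 1) := by
  by_contra hne
  obtain ⟨h₁, h₂⟩ := zeroRelation_iff.1 h
  refine hno C (i + 1) (.inr ⟨c, h₁.trans (C.target_eq_source i), hne, ?_⟩)
  rwa [add_sub_cancel_right]

lemma extVanishes_one_of_transGen {b : Quiver.Total V}
    (hb : Relation.TransGen (ZeroRelation I) b b) : ExtVanishes I b 1 := by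
  obtain ⟨C, rfl⟩ := exists_forbiddenCycle hb
  -- Here `b = a_0` and `c = a_1`. The failure of (B) at position 1 makes `c` unique, and the
  -- failure of (A) at position 2 gives `c' a_2 ≠ 0` for every other arrow `c'` ending there.
  refine hI.extVanishes_one (fun a ha => C.eq_of_zeroRelation hno ha) ⟨_, C.zeroRelation _⟩
    fun c' hr hne => ⟨C.a (0 + 1 + 1), (C.target_eq_source _).symm, fun h => ?_⟩
  rw [arr_mul_arr_eq_zero_iff] at h
  refine hno C (0 + 1 + 1) (.inl ⟨c', hr.trans (C.target_eq_source _), ?_, h⟩)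
  rwa [add_sub_cancel_right]

omit hI [Finite (Quiver.Total V)] in
-- An arrow on a cycle has a unique successor, so the closed walk through `b` passes through `c`.
lemma _root_.AlmostGentle.transGen_of_zeroRelation {b c : Quiver.Total V}
    (hb : Relation.TransGen (ZeroRelation I) b b) (hbc : ZeroRelation I b c) :
    Relation.TransGen (ZeroRelation I) c c := by
  obtain ⟨C, rfl⟩ := exists_forbiddenCycle hb
  obtain ⟨d, hd, hdb⟩ := Relation.TransGen.head'_iff.1 hb
  rw [C.eq_of_zeroRelation hno hd, ← C.eq_of_zeroRelation hno hbc] at hdb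
  exact Relation.TransGen.tail' hdb hbc

lemma extVanishes_of_transGen (n : ℕ) {b : Quiver.Total V}
    (hb : Relation.TransGen (ZeroRelation I) b b) : ExtVanishes I b (n + 1) := by
  induction n generalizing b with
  | zero => exact hI.extVanishes_one_of_transGen hno hb
  | succ n ih => exact hI.extVanishes_succ fun c hc => ih (transGen_of_zeroRelation hno hb hc)

lemma exists_forall_extVanishes (b : Quiver.Total V) :
    ∃ N, ∀ n, N ≤ n → ExtVanishes I b n := by
  -- Dropping the relations that leave an arrow on a cycle makes the transitive closure irreflexive,
  -- hence well founded on the finite set of arrows.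
  let r : Quiver.Total V → Quiver.Total V → Prop := fun c b =>
    ZeroRelation I b c ∧ ¬ Relation.TransGen (ZeroRelation I) b b
  have hr : ∀ {b c}, Relation.TransGen r c b →
      Relation.TransGen (ZeroRelation I) b c ∧ ¬ Relation.TransGen (ZeroRelation I) b b := by
    intro b c h
    induction h with
    | single h => exact ⟨.single h.1, h.2⟩
    | tail _ h ih => exact ⟨.head h.1 ih.1, h.2⟩
  have : Std.Irrefl (Relation.TransGen r) := ⟨fun b hb => (hr hb).2 (hr hb).1⟩
  have hwf : WellFounded (Relation.TransGen r) := Finite.wellFounded_of_trans_of_irrefl _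
  induction b using hwf.induction with
  | _ b ih =>
  by_cases hb : Relation.TransGen (ZeroRelation I) b b
  · refine ⟨1, fun n hn => ?_⟩
    obtain ⟨n, rfl⟩ := Nat.exists_eq_add_of_le' hn
    exact hI.extVanishes_of_transGen hno n hb
  · have := Fintype.ofFinite (Quiver.Total V)
    have ih' : ∀ c, ∃ N, ZeroRelation I b c → ∀ n, N ≤ n → ExtVanishes I c n := by
      intro c
      by_cases hc : ZeroRelation I b c
      · obtain ⟨N, hN⟩ := ih c (.single ⟨hc, hb⟩)
        exact ⟨N, fun _ => hN⟩
      · exact ⟨0, fun h => absurd h hc⟩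
    choose N hN using ih'
    -- The sum dominates the bound of every successor, and the extra one pays for the degree shift.
    refine ⟨∑ c, N c + 1, fun n hn => ?_⟩
    obtain ⟨n, rfl⟩ := Nat.exists_eq_add_of_le' (Nat.le_of_add_left_le hn)
    exact hI.extVanishes_succ fun c hc => hN c hc n
      ((Finset.single_le_sum (fun _ _ => Nat.zero_le _) (Finset.mem_univ c)).trans (by lia))

lemma exists_extVanishes : ∃ n, ∀ b : Quiver.Total V, ExtVanishes I b n := by
  have := Fintype.ofFinite (Quiver.Total V)
  choose N hN using hI.exists_forall_extVanishes hno
  exact ⟨∑ c, N c, fun b => hN b _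
    (Finset.single_le_sum (fun _ _ => Nat.zero_le _) (Finset.mem_univ b))⟩

end Finite

end IsAlmostGentlePair

end ForbiddenCycles

end AlmostGentle

theorem theorem5p5 {k : Type*} [Field k] {V : Type*} [Quiver V] [Fintype V]
    [∀ x y : V, Finite (x ⟶ y)]
    (I : TwoSidedIdeal (AlmostGentle.PathAlgebra k V))
    (hI : AlmostGentle.IsAlmostGentlePair I) :
    AlmostGentle.selfInjectiveDimension (AlmostGentle.BoundQuiverAlgebra I) = ⊤ ↔
      ∃ (C : AlmostGentle.ForbiddenCycle I) (i : ZMod C.len),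
        C.ConditionA i ∨ C.ConditionB i := by
  rw [AlmostGentle.selfInjectiveDimension]
  constructor
  · intro htop
    by_contra! hno
    obtain ⟨n, hn⟩ := hI.exists_extVanishes fun C i h => h.elim (hno C i).1 (hno C i).2
    exact (injectiveDimension_ne_top_iff _).2 ⟨n, hI.hasInjectiveDimensionLE hn⟩ htop
  · rintro ⟨C, i, h⟩
    by_contra htop
    obtain ⟨n, hn⟩ := (injectiveDimension_ne_top_iff _).1 htop
    exact hI.not_condition_of_extVanishes C
      -- Injective dimension at most `n` means less than `n + 1`, so `Ext` vanishes in degree `n +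
      -- 1`, which is positive as the shift around the cycle requires.
      (fun j => HasInjectiveDimensionLT.subsingleton _ (n + 1) (n + 1) le_rfl _) i h
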